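/- Let $(\mathrm C,\otimes,e)$ be a symmetric monoidal category (not necessarily strict) which has finite colimits and whose tensor product preserves finite colimits in each variable; in particular, any cocomplete symmetric monoidal category whose tensor product preserves colimits in each variable. *Notation.* A simplicial complex on $[n]=\{1,\dots,n\}$, $n\ge 0$, is a set of subsets of $[n]$ closed under taking subsets (ghost vertices are allowed); $\Delta_{[n]}$ is the set of all subsets, $\mathrm{pt}=\Delta_{[1]}$. A relative simplicial complex on $[n]$ is a pair $(K,L)$ of complexes on $[n]$ with $L\subseteq K$; let $\mathsf{relscpx}_{\ne(-,\emptyset)}(n)$ be the set of those with $L\neq\emptyset$, with right action $K\cdot\sigma=\{\sigma^{-1}(I)\mid I\in K\}$ of $\mathbb S_n$ on both members. For $(K,L)$ on $[n]$, $(M,N)$ on $[m]$ and $k\in[n]$ put $(K,L)\circ^*_k(M,N)=(K\triangleleft^*_k(M,N),\,L\triangleleft^*_k(M,N))$, where $K\triangleleft_k^*(M,N)$ is the complex on $[n+m-1]$ given by the union, over the faces $I\in K$, of the joins $P_1^I*\cdots*P_n^I$ with $P_k^I=M$ if $k\in I$, $P_k^I=N$ if $k\notin I$, and, for $i\neq k$,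 $P^I_i=\mathrm{pt}$ if $i\in I$, $P_i^I=\{\emptyset\}$ if $i\notin I$. This is a unital symmetric set operad with unit $(\mathrm{pt},\{\emptyset\})$ (the simplicial join operad). For arrows $f_i\colon Y_i\to X_i$ of $\mathrm C$, $i\in[n]$, the functor $z_n(-;\underline f)$ from the poset of subsets of $[n]$ to $\mathrm C$ sends $I$ to the tensor product, in increasing order of $i$, of the $X_i$ for $i\in I$ and the $Y_i$ for $i\notin I$, and an inclusion $I\subseteq J$ to the tensor product of the $f_i$, $i\in J\setminus I$, and identities. Let $\operatorname{cat}(K)$ be the poset of faces of a nonempty complex $K$. **Theorem.** The maps $$\overrightarrow{\mathcal M}_n((K,L);\underline f)=\Bigl(\operatorname*{colim}_{I\in\operatorname{cat}(L)}z_n(I;\underline f)\longrightarrow\operatorname*{colim}_{I\in\operatorname{cat}(K)}z_n(I;\underline f)\Bigr),$$ the arrow being the canonical morphism induced by $\operatorname{cat}(L)\subseteq\operatorname{cat}(K)$, make $\operatorname{Mor}(\mathrm C)$ into an algebra over $(\mathsf{relscpx}_{\neq(-,\emptyset)},\{\circ^*_k\})$, equalities of arrows being understood up to canonical isomorphism in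 the arrow category. Precisely: 1. They induce an algebra structure over this operad (a morphism to the endomorphism operad) on the isomorphism classes of arrows of $\mathrm C$. 2. For all $P=(K,L)$ of arity $n$, $Q=(M,N)$ of arity $m$, $\sigma\in\mathbb S_n$, $k\in[n]$ and all sequences $\underline f$ of arrows of the appropriate length, there are isomorphisms of arrows $$\overrightarrow{\mathcal M}_1((\mathrm{pt},\{\emptyset\});f)\cong f,\qquad \overrightarrow{\mathcal M}_n(P\cdot\sigma;f_1,\dots,f_n)\cong\overrightarrow{\mathcal M}_n(P;f_{\sigma^{-1}(1)},\dots,f_{\sigma^{-1}(n)}),$$ $$\overrightarrow{\mathcal M}_{n+m-1}(P\circ_k^*Q;\underline f)\cong\overrightarrow{\mathcal M}_n\bigl(P;f_1,\dots,f_{k-1},\overrightarrow{\mathcal M}_m(Q;f_k,\dots,f_{k+m-1}),f_{k+m},\dots,f_{n+m-1}\bigr),$$ each of them being the unique one which is compatible with the coprojections of the colimits through the structure isomorphisms of $\mathrm C$. That is, on the summands $z(I;\underline f)$ they are given respectively by: the unit isomorphism followed by the map of $f$ (an identity or $f$ itself); the symmetry $z_n(I;\underline f)\cong z_n(\sigma(I);\underline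 f\circ\sigma^{-1})$; and, for $I\in K$ (resp. $I\in L$) and $J\in M$ if $k\in I$, $J\in N$ if $k\notin I$, on the summand indexed by the set with part $J$ inside the $k$-th block and part $I\setminus\{k\}$ outside it, the associativity isomorphism grouping the $k$-th block of factors into $z_m(J;f_k,\dots,f_{k+m-1})$, followed by the coprojection of $J$ in the $k$-th factor and then by the coprojection of $I$. 3. This generalizes the algebras over the substitution and the composition operads on nonempty simplicial complexes. The pairs $(K,\{\emptyset\})$, resp. $(\Delta_{[n]},K)$, with $K\ne\emptyset$, are closed under the symmetric actions and the compositions and contain the unit. With $J+k-1$ and $[m]+k-1$ denoting shifts, $I^{<k}=I\cap[1,k-1]$ and $I^{>k}=I\cap[k+1,n]$, one has $(K,\{\emptyset\})\circ_k^*(L,\{\emptyset\})=(K\circ_kL,\{\emptyset\})$, where the faces of $K\circ_kL$ are $I^{<k}\sqcup(J+k-1)\sqcup(I^{>k}+m-1)$ for $k\in I\in K$, $J\in L$, and $I^{<k}\sqcup(I^{>k}+m-1)$ for $k\notin I\in K$; and $(\Delta_{[n]},K)\circ_k^*(\Delta_{[m]},L)=(\Delta_{[n+m-1]},K\circ^c_kL)$,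 where the faces of $K\circ_k^cL$ are $I^{<k}\sqcup(J+k-1)\sqcup(I^{>k}+m-1)$ for $k\notin I\in K$, $J\in L$, and $I^{<k}\sqcup(A+k-1)\sqcup(I^{>k}+m-1)$ for $k\in I\in K$, $A\subseteq[m]$. Moreover $\overrightarrow{\mathcal M}_n((K,\{\emptyset\});\underline f)$ is canonically isomorphic to $z_n(\emptyset;\underline f)\to\operatorname{colim}_{\operatorname{cat}(K)}z_n(-;\underline f)$, and $\overrightarrow{\mathcal M}_n((\Delta_{[n]},K);\underline f)$ to $\operatorname{colim}_{\operatorname{cat}(K)}z_n(-;\underline f)\to z_n([n];\underline f)$. -/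

import Mathlib

open CategoryTheory CategoryTheory.Limits CategoryTheory.MonoidalCategory

universe v u w

namespace JoinOperad

/-! ### Positions in a partial composition

Arities are kept in the form `p + 1 = n + m`, i.e. `p = n + m - 1`, so that no truncated
subtraction and no transport between equal arities is needed. Positions are numbered from `0`. -/

section Positions

variable {n m p : ℕ}

/-- The position in `Fin p` of the `i`-th input of an `n`-ary operation, `i ≠ k`, after its `k`-th
input has been replaced by a block of `m` inputs: `i` if `i < k`, and `i + m - 1` if `i > k`. -/
def outerPos (h : p + 1 = n + m) (k i : Fin n) (hi : i ≠ k) : Fin p :=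
  if hlt : i < k then ⟨i, by have := k.isLt; have := Fin.lt_def.1 hlt; omega⟩
  else ⟨i + m - 1, by have := i.isLt; have := Fin.val_ne_of_ne hi; have := Fin.lt_def.not.1 hlt; omega⟩

/-- The position in `Fin p` of the `j`-th input of the inserted block: `k + j`. -/
def innerPos (h : p + 1 = n + m) (k : Fin n) (j : Fin m) : Fin p :=
  ⟨k + j, by have := k.isLt; have := j.isLt; omega⟩

theorem outer_val_of_lt (h : p + 1 = n + m) {k i : Fin n} (hi : i ≠ k) (hlt : i < k) :
    (outerPos h k i hi : ℕ) = i := by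
  simp [outerPos, hlt]

theorem outer_val_of_gt (h : p + 1 = n + m) {k i : Fin n} (hi : i ≠ k) (hlt : k < i) :
    (outerPos h k i hi : ℕ) + 1 = i + m := by
  have h1 : ¬ i < k := not_lt.2 hlt.le
  have := Fin.lt_def.1 hlt
  simp only [outerPos, h1, dite_false]
  omega

@[simp] theorem inner_val (h : p + 1 = n + m) (k : Fin n) (j : Fin m) :
    (innerPos h k j : ℕ) = k + j := rfl

theorem outer_val (h : p + 1 = n + m) (k i : Fin n) (hi : i ≠ k) :
    ((i : ℕ) < k ∧ (outerPos h k i hi : ℕ) = i) ∨ ((k : ℕ) < i ∧ (outerPos h k i hi : ℕ) + 1 = i + m) := by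
  rcases lt_or_gt_of_ne hi with hlt | hlt
  · exact Or.inl ⟨hlt, outer_val_of_lt h hi hlt⟩
  · exact Or.inr ⟨hlt, outer_val_of_gt h hi hlt⟩

theorem outer_eq_iff (h : p + 1 = n + m) (k i : Fin n) (hi : i ≠ k) (q : Fin p) :
    outerPos h k i hi = q ↔
      ((i : ℕ) < k ∧ (q : ℕ) = i) ∨ ((k : ℕ) < i ∧ (q : ℕ) + 1 = i + m) := by
  rw [Fin.ext_iff]
  have := outer_val h k i hi
  omega

theorem inner_eq_iff (h : p + 1 = n + m) (k : Fin n) (j : Fin m) (q : Fin p) :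
    innerPos h k j = q ↔ (q : ℕ) = k + j := by
  rw [Fin.ext_iff, inner_val]; omega

/-- Every position is either an outer or an inner one, in exactly one way. -/
theorem position_bijective (h : p + 1 = n + m) (k : Fin n) :
    Function.Bijective (Sum.elim (fun i : {i : Fin n // i ≠ k} => outerPos h k i.1 i.2)
      (fun j : Fin m => innerPos h k j)) := by
  constructor
  · rintro (⟨i, hi⟩ | j) (⟨i', hi'⟩ | j') he
    · simp only [Sum.elim_inl, outer_eq_iff] at he
      have := outer_val h k i' hi'
      simp only [Sum.inl.injEq, Subtype.mk.injEq, Fin.ext_iff]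
      omega
    · simp only [Sum.elim_inl, Sum.elim_inr, outer_eq_iff, inner_val] at he
      have := j'.isLt
      omega
    · simp only [Sum.elim_inl, Sum.elim_inr, inner_eq_iff] at he
      have := j.isLt
      have := outer_val h k i' hi'
      omega
    · simp only [Sum.elim_inr, inner_eq_iff, inner_val] at he
      simp only [Sum.inr.injEq, Fin.ext_iff]
      omega
  · intro q
    have hq := q.isLt
    have hk := k.isLt
    rcases lt_or_ge (q : ℕ) k with h1 | h1
    · refine ⟨Sum.inl ⟨⟨q, by omega⟩, fun hc => ?_⟩, ?_⟩
      · rw [Fin.ext_iff] at hc; simp only at hc; omega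
      · simp only [Sum.elim_inl, outer_eq_iff]; exact Or.inl ⟨h1, True.intro⟩
    rcases lt_or_ge (q : ℕ) (k + m) with h2 | h2
    · refine ⟨Sum.inr ⟨q - k, by omega⟩, ?_⟩
      simp only [Sum.elim_inr, inner_eq_iff]; omega
    · refine ⟨Sum.inl ⟨⟨q + 1 - m, by omega⟩, fun hc => ?_⟩, ?_⟩
      · rw [Fin.ext_iff] at hc; simp only at hc; omega
      · simp only [Sum.elim_inl, outer_eq_iff]; omega

/-- The decomposition of the positions into outer and inner ones. -/
noncomputable def positionEquiv (h : p + 1 = n + m) (k : Fin n) :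
    {i : Fin n // i ≠ k} ⊕ Fin m ≃ Fin p :=
  Equiv.ofBijective _ (position_bijective h k)

@[simp] theorem positionEquiv_inl (h : p + 1 = n + m) (k : Fin n) (i : {i : Fin n // i ≠ k}) :
    positionEquiv h k (Sum.inl i) = outerPos h k i.1 i.2 := rfl

@[simp] theorem positionEquiv_inr (h : p + 1 = n + m) (k : Fin n) (j : Fin m) :
    positionEquiv h k (Sum.inr j) = innerPos h k j := rfl

/-- The composite `σ ∘ₖ τ` of two permutations: the permutation of the `p` positions which moves the
inserted block from slot `k` to slot `σ k`, permutes the other slots by `σ`, and permutes the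
inside of the block by `τ`. -/
noncomputable def permComp (h : p + 1 = n + m) (k : Fin n) (σ : Equiv.Perm (Fin n))
    (τ : Equiv.Perm (Fin m)) : Equiv.Perm (Fin p) :=
  (positionEquiv h k).symm.trans
    ((Equiv.sumCongr
      (σ.subtypeEquiv (fun i => (σ.injective.ne_iff (x := i) (y := k)).symm)) τ).trans
      (positionEquiv h (σ k)))

theorem permComp_outer (h : p + 1 = n + m) (k : Fin n) (σ : Equiv.Perm (Fin n))
    (τ : Equiv.Perm (Fin m)) (i : Fin n) (hi : i ≠ k) :
    permComp h k σ τ (outerPos h k i hi) = outerPos h (σ k) (σ i) (σ.injective.ne hi) := by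
  have : (positionEquiv h k).symm (outerPos h k i hi) = Sum.inl ⟨i, hi⟩ := by
    rw [Equiv.symm_apply_eq]; rfl
  simp [permComp, this]

theorem permComp_inner (h : p + 1 = n + m) (k : Fin n) (σ : Equiv.Perm (Fin n))
    (τ : Equiv.Perm (Fin m)) (j : Fin m) :
    permComp h k σ τ (innerPos h k j) = innerPos h (σ k) (τ j) := by
  have : (positionEquiv h k).symm (innerPos h k j) = Sum.inr j := by
    rw [Equiv.symm_apply_eq]; rfl
  simp [permComp, this]

/-- The sequence `(x₁, …, xₖ₋₁, y, xₖ₊ₘ, …)` obtained from `x` by replacing the block of `m` entries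
starting at `k` by the single entry `y`. -/
def insertAt {X : Type*} (h : p + 1 = n + m) (k : Fin n) (x : Fin p → X) (y : X) : Fin n → X :=
  fun i => if hi : i = k then y else x (outerPos h k i hi)

theorem insertAt_self {X : Type*} (h : p + 1 = n + m) (k : Fin n) (x : Fin p → X) (y : X) :
    insertAt h k x y k = y := by simp [insertAt]

theorem insertAt_of_ne {X : Type*} (h : p + 1 = n + m) {k i : Fin n} (hi : i ≠ k) (x : Fin p → X)
    (y : X) : insertAt h k x y i = x (outerPos h k i hi) := by simp [insertAt, hi]

end Positions

/-! ### Set operads and their algebras -/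

/-- A (unital, symmetric) set operad: sets `O(n)` with right actions of the symmetric groups and
partial compositions `∘ₖ : O(n) × O(m) → O(n + m - 1)`. -/
structure SetOperad where
  /-- the set of operations of arity `n` -/
  Op : ℕ → Type w
  /-- the right action of the symmetric group -/
  act : ∀ {n : ℕ}, Op n → Equiv.Perm (Fin n) → Op n
  /-- the partial composition at the input `k` -/
  comp : ∀ {n m p : ℕ}, p + 1 = n + m → Fin n → Op n → Op m → Op p
  /-- the identity operation -/
  one : Op 1
  act_one : ∀ {n : ℕ} (A : Op n), act A 1 = A
  act_mul : ∀ {n : ℕ} (A : Op n) (σ τ : Equiv.Perm (Fin n)), act A (σ * τ) = act (act A σ) τ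
  one_comp : ∀ {m : ℕ} (h : m + 1 = 1 + m) (A : Op m), comp h 0 one A = A
  comp_one : ∀ {n : ℕ} (h : n + 1 = n + 1) (k : Fin n) (A : Op n), comp h k A one = A
  /-- sequential axiom: `A ∘ᵢ (B ∘ⱼ C) = (A ∘ᵢ B) ∘ᵢ₊ⱼ C` (indices starting at `0`) -/
  comp_sequential : ∀ {l n m p q r : ℕ} (h₁ : q + 1 = n + m) (h₂ : r + 1 = l + q)
    (h₃ : p + 1 = l + n) (h₄ : r + 1 = p + m) (i : Fin l) (j : Fin n)
    (A : Op l) (B : Op n) (C : Op m),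
    comp h₂ i A (comp h₁ j B C) = comp h₄ (innerPos h₃ i j) (comp h₃ i A B) C
  /-- parallel axiom: for `i < j`, inserting `B` at `i` and `C` at `j` can be done in any order -/
  comp_parallel : ∀ {l n m p q r : ℕ} (h₁ : p + 1 = l + n) (h₂ : r + 1 = p + m)
    (h₃ : q + 1 = l + m) (h₄ : r + 1 = q + n) (i j : Fin l) (hij : i < j)
    (A : Op l) (B : Op n) (C : Op m),
    comp h₂ (outerPos h₁ i j hij.ne') (comp h₁ i A B) C =
      comp h₄ (outerPos h₃ j i hij.ne) (comp h₃ j A C) B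
  /-- equivariance: `(A · σ) ∘ₖ (B · τ) = (A ∘_{σ k} B) · (σ ∘ₖ τ)` -/
  comp_equivariant : ∀ {n m p : ℕ} (h : p + 1 = n + m) (k : Fin n) (A : Op n) (B : Op m)
    (σ : Equiv.Perm (Fin n)) (τ : Equiv.Perm (Fin m)),
    comp h k (act A σ) (act B τ) = act (comp h (σ k) A B) (permComp h k σ τ)

/-- An algebra structure on the set `X` over a set operad `O`, i.e. a morphism of operads from `O`
to the endomorphism operad `Endₓ(n) = (Xⁿ → X)` of `X`, whose right symmetric action is
`(f · σ)(x₁, …, xₙ) = f (x_{σ⁻¹ 1}, …, x_{σ⁻¹ n})` and whose partial compositions are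
`(f ∘ₖ g)(x) = f (x₁, …, xₖ₋₁, g (xₖ, …, xₖ₊ₘ₋₁), xₖ₊ₘ, …)`. -/
structure SetOperad.Algebra (O : SetOperad.{w}) (X : Type u) where
  /-- the structure maps -/
  map : ∀ {n : ℕ}, O.Op n → (Fin n → X) → X
  map_one : ∀ x : Fin 1 → X, map O.one x = x 0
  map_act : ∀ {n : ℕ} (A : O.Op n) (σ : Equiv.Perm (Fin n)) (x : Fin n → X),
    map (O.act A σ) x = map A (x ∘ σ.symm)
  map_comp : ∀ {n m p : ℕ} (h : p + 1 = n + m) (k : Fin n) (A : O.Op n) (B : O.Op m)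
    (x : Fin p → X),
    map (O.comp h k A B) x = map A (insertAt h k x (map B (fun j => x (innerPos h k j))))

/-! ### Simplicial complexes and relative simplicial complexes -/

/-- A simplicial complex on the vertex set `Fin n`: a set of subsets of `Fin n`, the faces, which is
closed under passing to subsets. It may have ghost vertices, it may be the trivial complex `{∅}`, and
it may have no face at all (the empty complex). -/
abbrev SimplicialCpx (n : ℕ) := LowerSet (Finset (Fin n))

namespace SimplicialCpx

variable {n m p : ℕ}

/-- The full simplex `Δ_[n]`. -/
def simplex (n : ℕ) : SimplicialCpx n := ⊤

/-- The trivial complex `{∅}`. -/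
def trivial (n : ℕ) : SimplicialCpx n := LowerSet.Iic ∅

@[simp] theorem mem_simplex (I : Finset (Fin n)) : I ∈ simplex n := LowerSet.mem_top

@[simp] theorem mem_trivial (I : Finset (Fin n)) : I ∈ trivial n ↔ I = ∅ := by
  simp [trivial]

theorem empty_mem {K : SimplicialCpx n} (hK : (K : Set (Finset (Fin n))).Nonempty) : ∅ ∈ K :=
  hK.elim fun _ hI => K.lower (Finset.empty_subset _) hI

/-- The right action of the symmetric group: `K · σ = {σ⁻¹(I) | I ∈ K}`. -/
def act (K : SimplicialCpx n) (σ : Equiv.Perm (Fin n)) : SimplicialCpx n where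
  carrier := {I | I.map σ.toEmbedding ∈ K}
  lower' _ _ hJI hI := K.lower (Finset.map_subset_map.2 hJI) hI

@[simp] theorem mem_act (K : SimplicialCpx n) (σ : Equiv.Perm (Fin n)) (I : Finset (Fin n)) :
    I ∈ K.act σ ↔ I.map σ.toEmbedding ∈ K := Iff.rfl

/-- The part of a set of positions inside the inserted block. -/
def innerPart (h : p + 1 = n + m) (k : Fin n) (S : Finset (Fin p)) : Finset (Fin m) :=
  Finset.univ.filter fun j => innerPos h k j ∈ S

/-- The part of a set of positions outside the inserted block. -/
def outerPart (h : p + 1 = n + m) (k : Fin n) (S : Finset (Fin p)) : Finset (Fin n) :=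
  Finset.univ.filter fun i => ∃ hi : i ≠ k, outerPos h k i hi ∈ S

@[simp] theorem mem_innerPart (h : p + 1 = n + m) (k : Fin n) (S : Finset (Fin p)) (j : Fin m) :
    j ∈ innerPart h k S ↔ innerPos h k j ∈ S := by simp [innerPart]

@[simp] theorem mem_outerPart (h : p + 1 = n + m) (k : Fin n) (S : Finset (Fin p)) (i : Fin n) :
    i ∈ outerPart h k S ↔ ∃ hi : i ≠ k, outerPos h k i hi ∈ S := by simp [outerPart]

theorem innerPart_mono (h : p + 1 = n + m) (k : Fin n) {S T : Finset (Fin p)} (hST : S ⊆ T) :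
    innerPart h k S ⊆ innerPart h k T := fun j => by
  simpa using fun hj => hST hj

theorem outerPart_mono (h : p + 1 = n + m) (k : Fin n) {S T : Finset (Fin p)} (hST : S ⊆ T) :
    outerPart h k S ⊆ outerPart h k T := fun i => by
  simpa using fun hi hj => ⟨hi, hST hj⟩

/-- The simplicial join product of `K` with respect to the pairs
`(pt, {∅}), …, (pt, {∅}), (M, N), (pt, {∅}), …, (pt, {∅})`, with `(M, N)` at the index `k`.
It is the union over the faces `I` of `K` of the joins `P₁ * ⋯ * Pₙ`, where, for `i ≠ k`, the
complex `Pᵢ` on one vertex is `pt` if `i ∈ I` and `{∅}` otherwise, and where the complex `Pₖ` on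
`m` vertices is `M` if `k ∈ I` and `N` otherwise. A set of vertices is a face of a join when each
of its parts is a face of the corresponding factor. -/
def joinAction (h : p + 1 = n + m) (k : Fin n) (K : SimplicialCpx n) (M N : SimplicialCpx m) : SimplicialCpx p where
  carrier := {S | ∃ I ∈ K, (∀ (i : Fin n) (hi : i ≠ k), outerPos h k i hi ∈ S → i ∈ I) ∧
    innerPart h k S ∈ (if k ∈ I then M else N)}
  lower' := by
    rintro S T hTS ⟨I, hI, h1, h2⟩
    exact ⟨I, hI, fun i hi hS => h1 i hi (hTS hS), LowerSet.lower _ (innerPart_mono h k hTS) h2⟩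

theorem mem_joinAction' (h : p + 1 = n + m) (k : Fin n) (K : SimplicialCpx n) (M N : SimplicialCpx m)
    (S : Finset (Fin p)) : S ∈ joinAction h k K M N ↔
      ∃ I ∈ K, (∀ (i : Fin n) (hi : i ≠ k), outerPos h k i hi ∈ S → i ∈ I) ∧
        innerPart h k S ∈ (if k ∈ I then M else N) := Iff.rfl

/-- Description of the faces of the simplicial join product by their two parts. -/
theorem mem_joinAction (h : p + 1 = n + m) (k : Fin n) (K : SimplicialCpx n) (M N : SimplicialCpx m)
    (S : Finset (Fin p)) : S ∈ joinAction h k K M N ↔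
      (insert k (outerPart h k S) ∈ K ∧ innerPart h k S ∈ M) ∨
        (outerPart h k S ∈ K ∧ innerPart h k S ∈ N) := by
  rw [mem_joinAction']
  constructor
  · rintro ⟨I, hI, h1, h2⟩
    have h3 : outerPart h k S ⊆ I := fun i hi => by
      obtain ⟨hi, hS⟩ := (mem_outerPart h k S i).1 hi
      exact h1 i hi hS
    by_cases hk : k ∈ I
    · rw [if_pos hk] at h2
      exact Or.inl ⟨K.lower (Finset.insert_subset hk h3) hI, h2⟩
    · rw [if_neg hk] at h2
      exact Or.inr ⟨K.lower h3 hI, h2⟩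
  · rintro (⟨h1, h2⟩ | ⟨h1, h2⟩)
    · refine ⟨_, h1, fun i hi hS => Finset.mem_insert_of_mem ((mem_outerPart h k S i).2 ⟨hi, hS⟩), ?_⟩
      simpa using h2
    · refine ⟨_, h1, fun i hi hS => (mem_outerPart h k S i).2 ⟨hi, hS⟩, ?_⟩
      have : k ∉ outerPart h k S := fun hk => ((mem_outerPart h k S k).1 hk).1 rfl
      rwa [if_neg this]

theorem joinAction_mono (h : p + 1 = n + m) (k : Fin n) {K L : SimplicialCpx n} (hLK : L ≤ K)
    (M N : SimplicialCpx m) : joinAction h k L M N ≤ joinAction h k K M N := by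
  rintro S ⟨I, hI, hS⟩
  exact ⟨I, hLK hI, hS⟩

theorem joinAction_trivial_pt (h : n + 1 = n + 1) (k : Fin n) (K : SimplicialCpx n) :
    joinAction h k K (simplex 1) (trivial 1) = K := by
  have ho : ∀ i (hi : i ≠ k), outerPos h k i hi = i := fun i hi => by
    rw [outer_eq_iff]; have := Fin.val_ne_of_ne hi; omega
  have hin : ∀ j, innerPos h k j = k := fun j => by
    rw [inner_eq_iff]; omega
  ext S
  simp only [SetLike.mem_coe, mem_joinAction, mem_simplex, and_true, mem_trivial]
  by_cases hk : k ∈ S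
  · have h1 : insert k (outerPart h k S) = S := by
      ext i; by_cases hik : i = k <;> simp [ho, hik, hk]
    have h2 : innerPart h k S ≠ ∅ := by
      apply Finset.Nonempty.ne_empty
      exact ⟨0, by simp [hin, hk]⟩
    simp [h1, h2]
  · have h1 : outerPart h k S = S := by
      ext i; by_cases hik : i = k <;> simp [ho, hik, hk]
    have h2 : innerPart h k S = ∅ := by
      ext j; simp [hin, hk]
    simp only [h1, h2, and_true, or_iff_right_iff_imp]
    exact fun hS => K.lower (Finset.subset_insert _ _) hS

theorem pt_joinAction (h : m + 1 = 1 + m) (M N : SimplicialCpx m) (hNM : N ≤ M) :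
    joinAction h 0 (simplex 1) M N = M := by
  have hin : ∀ j : Fin m, innerPos h 0 j = j := fun j => by
    rw [inner_eq_iff]; simp
  ext S
  have h2 : innerPart h 0 S = S := by ext j; simp [hin]
  simp only [SetLike.mem_coe, mem_joinAction, mem_simplex, true_and, h2, or_iff_left_iff_imp]
  exact fun hS => hNM hS

theorem trivial_joinAction (h : m + 1 = 1 + m) (M N : SimplicialCpx m) :
    joinAction h 0 (trivial 1) M N = N := by
  have hin : ∀ j : Fin m, innerPos h 0 j = j := fun j => by
    rw [inner_eq_iff]; simp
  ext S
  have h2 : innerPart h 0 S = S := by ext j; simp [hin]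
  have h1 : outerPart h 0 S = ∅ := by
    ext i; have : i = 0 := Subsingleton.elim _ _; simp [this]
  simp [mem_joinAction, h2, h1]

theorem joinAction_sequential {l n m p q r : ℕ} (h₁ : q + 1 = n + m) (h₂ : r + 1 = l + q)
    (h₃ : p + 1 = l + n) (h₄ : r + 1 = p + m) (i : Fin l) (j : Fin n)
    (K : SimplicialCpx l) (M N : SimplicialCpx n) (O P : SimplicialCpx m) :
    joinAction h₂ i K (joinAction h₁ j M O P) (joinAction h₁ j N O P) =
      joinAction h₄ (innerPos h₃ i j) (joinAction h₃ i K M N) O P := by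
  ext S
  have hin : ∀ a : Fin m, innerPos h₂ i (innerPos h₁ j a) = innerPos h₄ (innerPos h₃ i j) a := fun a => by
    rw [inner_eq_iff]; simp; omega
  have hc : innerPart h₁ j (innerPart h₂ i S) = innerPart h₄ (innerPos h₃ i j) S := by
    ext a; simp [hin]
  have hne : ∀ a (ha : a ≠ i), outerPos h₃ i a ha ≠ innerPos h₃ i j := fun a ha he => by
    rw [outer_eq_iff] at he; simp at he; omega
  have hout : ∀ a (ha : a ≠ i),
      outerPos h₄ (innerPos h₃ i j) (outerPos h₃ i a ha) (hne a ha) = outerPos h₂ i a ha := fun a ha => by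
    rw [outer_eq_iff]
    have h5 := outer_val h₃ i a ha
    have h6 := outer_val h₂ i a ha
    have := j.isLt
    simp only [inner_val]
    omega
  have hne' : ∀ b, b ≠ j → innerPos h₃ i b ≠ innerPos h₃ i j := fun b hb he => by
    rw [inner_eq_iff] at he; simp at he; exact hb (Fin.ext (by omega))
  have hmid : ∀ b (hb : b ≠ j), outerPos h₄ (innerPos h₃ i j) (innerPos h₃ i b) (hne' b hb) =
      innerPos h₂ i (outerPos h₁ j b hb) := fun b hb => by
    rw [outer_eq_iff]
    have h5 := outer_val h₁ j b hb
    simp only [inner_val]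
    omega
  have hA : outerPart h₃ i (outerPart h₄ (innerPos h₃ i j) S) = outerPart h₂ i S := by
    ext a
    simp only [mem_outerPart]
    constructor
    · rintro ⟨ha, h7, h8⟩; exact ⟨ha, by rwa [hout] at h8⟩
    · rintro ⟨ha, h7⟩; exact ⟨ha, hne a ha, by rwa [hout]⟩
  have hB : innerPart h₃ i (outerPart h₄ (innerPos h₃ i j) S) = outerPart h₁ j (innerPart h₂ i S) := by
    ext b
    simp only [mem_outerPart, mem_innerPart]
    constructor
    · rintro ⟨h7, h8⟩
      have hb : b ≠ j := fun hb => h7 (by rw [hb])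
      exact ⟨hb, by rwa [hmid b hb] at h8⟩
    · rintro ⟨hb, h7⟩; exact ⟨hne' b hb, by rwa [hmid]⟩
  have hA' : outerPart h₃ i (insert (innerPos h₃ i j) (outerPart h₄ (innerPos h₃ i j) S)) =
      outerPart h₂ i S := by
    rw [← hA]; ext a
    simp only [mem_outerPart, Finset.mem_insert]
    constructor
    · rintro ⟨ha, h7 | h7⟩
      · exact absurd h7 (hne a ha)
      · exact ⟨ha, h7⟩
    · rintro ⟨ha, h7⟩; exact ⟨ha, Or.inr h7⟩
  have hB' : innerPart h₃ i (insert (innerPos h₃ i j) (outerPart h₄ (innerPos h₃ i j) S)) =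
      insert j (outerPart h₁ j (innerPart h₂ i S)) := by
    rw [← hB]; ext b
    simp only [mem_innerPart, Finset.mem_insert]
    have : innerPos h₃ i b = innerPos h₃ i j ↔ b = j :=
      ⟨fun he => by by_contra hb; exact hne' b hb he, fun he => by rw [he]⟩
    rw [this]
  simp only [SetLike.mem_coe, mem_joinAction, hA, hB, hA', hB', hc]
  tauto

set_option maxHeartbeats 1000000 in
theorem joinAction_parallel {l n m p q r : ℕ} (h₁ : p + 1 = l + n) (h₂ : r + 1 = p + m)
    (h₃ : q + 1 = l + m) (h₄ : r + 1 = q + n) (i j : Fin l) (hij : i ≠ j)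
    (K : SimplicialCpx l) (M N : SimplicialCpx n) (O P : SimplicialCpx m) :
    joinAction h₂ (outerPos h₁ i j hij.symm) (joinAction h₁ i K M N) O P =
      joinAction h₄ (outerPos h₃ j i hij) (joinAction h₃ j K O P) M N := by
  have hij' : (i : ℕ) ≠ j := Fin.val_ne_of_ne hij
  have h5 := outer_val h₁ i j hij.symm
  have h6 := outer_val h₃ j i hij
  have hne1 : ∀ b, innerPos h₁ i b ≠ outerPos h₁ i j hij.symm := fun b he => by
    have := b.isLt
    rw [inner_eq_iff] at he; omega
  have hne2 : ∀ c, innerPos h₃ j c ≠ outerPos h₃ j i hij := fun b he => by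
    have := b.isLt
    rw [inner_eq_iff] at he; omega
  have hb : ∀ b, outerPos h₂ (outerPos h₁ i j hij.symm) (innerPos h₁ i b) (hne1 b) =
      innerPos h₄ (outerPos h₃ j i hij) b := fun b => by
    have := b.isLt
    rw [outer_eq_iff]; simp only [inner_val]; omega
  have hc : ∀ c, outerPos h₄ (outerPos h₃ j i hij) (innerPos h₃ j c) (hne2 c) =
      innerPos h₂ (outerPos h₁ i j hij.symm) c := fun c => by
    have := c.isLt
    rw [outer_eq_iff]; simp only [inner_val]; omega
  have hne3 : ∀ a (h1 : a ≠ i), a ≠ j → outerPos h₁ i a h1 ≠ outerPos h₁ i j hij.symm :=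
    fun a h1 h2 he => by
      have := Fin.val_ne_of_ne h2
      rw [outer_eq_iff] at he; omega
  have hne4 : ∀ a (h2 : a ≠ j), a ≠ i → outerPos h₃ j a h2 ≠ outerPos h₃ j i hij :=
    fun a h2 h1 he => by
      have := Fin.val_ne_of_ne h1
      rw [outer_eq_iff] at he; omega
  have ha : ∀ a (h1 : a ≠ i) (h2 : a ≠ j),
      outerPos h₂ (outerPos h₁ i j hij.symm) (outerPos h₁ i a h1) (hne3 a h1 h2) =
        outerPos h₄ (outerPos h₃ j i hij) (outerPos h₃ j a h2) (hne4 a h2 h1) := fun a h1 h2 => by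
    have h7 := outer_val h₁ i a h1
    have h8 := outer_val h₃ j a h2
    have h9 := outer_val h₄ (outerPos h₃ j i hij) (outerPos h₃ j a h2) (hne4 a h2 h1)
    have := Fin.val_ne_of_ne h1
    have := Fin.val_ne_of_ne h2
    rw [outer_eq_iff]; omega
  ext S
  have f1 : ∀ X, innerPart h₁ i (insert (outerPos h₁ i j hij.symm) X) = innerPart h₁ i X := fun X => by
    ext b; simp [hne1]
  have f2 : ∀ X, innerPart h₃ j (insert (outerPos h₃ j i hij) X) = innerPart h₃ j X := fun X => by
    ext c; simp [hne2]
  have f3 : ∀ X, outerPart h₁ i (insert (outerPos h₁ i j hij.symm) X) =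
      insert j (outerPart h₁ i X) := fun X => by
    ext a
    by_cases haj : a = j
    · subst haj; simp [hij.symm]
    · simp only [mem_outerPart, Finset.mem_insert, haj, false_or]
      exact exists_congr fun h1 => or_iff_right (hne3 a h1 haj)
  have f4 : ∀ X, outerPart h₃ j (insert (outerPos h₃ j i hij) X) =
      insert i (outerPart h₃ j X) := fun X => by
    ext a
    by_cases haj : a = i
    · subst haj; simp [hij]
    · simp only [mem_outerPart, Finset.mem_insert, haj, false_or]
      exact exists_congr fun h1 => or_iff_right (hne4 a h1 haj)
  have f5 : innerPart h₁ i (outerPart h₂ (outerPos h₁ i j hij.symm) S) =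
      innerPart h₄ (outerPos h₃ j i hij) S := by
    ext b
    simp only [mem_innerPart, mem_outerPart, hb]
    exact exists_prop_of_true (hne1 b)
  have f6 : innerPart h₃ j (outerPart h₄ (outerPos h₃ j i hij) S) =
      innerPart h₂ (outerPos h₁ i j hij.symm) S := by
    ext b
    simp only [mem_innerPart, mem_outerPart, hc]
    exact exists_prop_of_true (hne2 b)
  have f7 : outerPart h₁ i (outerPart h₂ (outerPos h₁ i j hij.symm) S) =
      outerPart h₃ j (outerPart h₄ (outerPos h₃ j i hij) S) := by
    ext a
    simp only [mem_outerPart]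
    constructor
    · rintro ⟨h1, h2, h7⟩
      have haj : a ≠ j := fun he => h2 (by subst he; rfl)
      exact ⟨haj, hne4 a haj h1, by rwa [← ha a h1 haj]⟩
    · rintro ⟨h1, h2, h7⟩
      have haj : a ≠ i := fun he => h2 (by subst he; rfl)
      exact ⟨haj, hne3 a haj h1, by rwa [ha a haj h1]⟩
  simp only [SetLike.mem_coe, mem_joinAction, f1, f2, f3, f4, f5, f6, f7]
  rw [Finset.insert_comm i j]
  tauto

theorem joinAction_equivariant (h : p + 1 = n + m) (k : Fin n) (K : SimplicialCpx n) (M N : SimplicialCpx m)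
    (σ : Equiv.Perm (Fin n)) (τ : Equiv.Perm (Fin m)) :
    joinAction h k (K.act σ) (M.act τ) (N.act τ) =
      (joinAction h (σ k) K M N).act (permComp h k σ τ) := by
  ext S
  have f1 : innerPart h (σ k) (S.map (permComp h k σ τ).toEmbedding) =
      (innerPart h k S).map τ.toEmbedding := by
    ext b
    obtain ⟨b, rfl⟩ := τ.surjective b
    simp [← permComp_inner]
  have f2 : outerPart h (σ k) (S.map (permComp h k σ τ).toEmbedding) =
      (outerPart h k S).map σ.toEmbedding := by
    ext a
    obtain ⟨a, rfl⟩ := σ.surjective a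
    by_cases hak : a = k
    · subst hak; simp
    · simp only [mem_outerPart, Finset.mem_map_equiv, Equiv.symm_apply_apply, ne_eq,
        EmbeddingLike.apply_eq_iff_eq, hak, not_false_eq_true, exists_true_left]
      rw [← permComp_outer h k σ τ a hak, Equiv.symm_apply_apply]
  simp only [SetLike.mem_coe, mem_joinAction, mem_act, f1, f2, Finset.map_insert,
    Equiv.coe_toEmbedding]

/-- The substitution `K ∘ₖ L` of simplicial complexes: its faces are
`I^{<k} ⊔ (J + k - 1) ⊔ (I^{>k} + m - 1)` for `k ∈ I ∈ K`, `J ∈ L`, and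
`I^{<k} ⊔ (I^{>k} + m - 1)` for `k ∉ I ∈ K`. -/
def subst (h : p + 1 = n + m) (k : Fin n) (K : SimplicialCpx n) (L : SimplicialCpx m) : Set (Finset (Fin p)) :=
  {S | ∃ I ∈ K, outerPart h k S = I.erase k ∧
    ((k ∈ I ∧ innerPart h k S ∈ L) ∨ (k ∉ I ∧ innerPart h k S = ∅))}

/-- The composition `K ∘ᶜₖ L` of simplicial complexes: its faces are
`I^{<k} ⊔ (J + k - 1) ⊔ (I^{>k} + m - 1)` for `k ∉ I ∈ K`, `J ∈ L`, and
`I^{<k} ⊔ (A + k - 1) ⊔ (I^{>k} + m - 1)` for `k ∈ I ∈ K` and an arbitrary set `A`. -/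
def compo (h : p + 1 = n + m) (k : Fin n) (K : SimplicialCpx n) (L : SimplicialCpx m) : Set (Finset (Fin p)) :=
  {S | ∃ I ∈ K, outerPart h k S = I.erase k ∧ (k ∈ I ∨ (k ∉ I ∧ innerPart h k S ∈ L))}

end SimplicialCpx

/-- A relative simplicial complex `(K, L)` on `Fin n` with `L ≠ ∅`. -/
@[ext]
structure RelComplex (n : ℕ) where
  /-- the ambient complex -/
  K : SimplicialCpx n
  /-- the subcomplex -/
  L : SimplicialCpx n
  le : L ≤ K
  nonempty : (L : Set (Finset (Fin n))).Nonempty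

namespace RelComplex

variable {n m p : ℕ}

/-- The right action of the symmetric group. -/
def act (P : RelComplex n) (σ : Equiv.Perm (Fin n)) : RelComplex n where
  K := P.K.act σ
  L := P.L.act σ
  le _ hI := P.le hI
  nonempty := ⟨∅, by simpa using SimplicialCpx.empty_mem P.nonempty⟩

/-- The join composition `(K, L) ∘*ₖ (M, N) = (K ◁*ₖ (M, N), L ◁*ₖ (M, N))`. -/
def comp (h : p + 1 = n + m) (k : Fin n) (P : RelComplex n) (Q : RelComplex m) : RelComplex p where
  K := SimplicialCpx.joinAction h k P.K Q.K Q.L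
  L := SimplicialCpx.joinAction h k P.L Q.K Q.L
  le := SimplicialCpx.joinAction_mono h k P.le Q.K Q.L
  nonempty := ⟨∅, ∅, SimplicialCpx.empty_mem P.nonempty, by simp, by
    simpa [SimplicialCpx.innerPart] using SimplicialCpx.empty_mem Q.nonempty⟩

/-- The unit `(pt, {∅})`. -/
def unit : RelComplex 1 where
  K := SimplicialCpx.simplex 1
  L := SimplicialCpx.trivial 1
  le _ _ := SimplicialCpx.mem_simplex _
  nonempty := ⟨∅, by simp⟩

/-- The relative complex `(K, {∅})` attached to a nonempty simplicial complex `K`. -/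
def ofSubst (K : SimplicialCpx n) (hK : (K : Set (Finset (Fin n))).Nonempty) : RelComplex n where
  K := K
  L := SimplicialCpx.trivial n
  le I hI := by
    rw [(SimplicialCpx.mem_trivial I).1 hI]
    exact SimplicialCpx.empty_mem hK
  nonempty := ⟨∅, by simp⟩

/-- The relative complex `(Δ_[n], K)` attached to a nonempty simplicial complex `K`. -/
def ofCompo (K : SimplicialCpx n) (hK : (K : Set (Finset (Fin n))).Nonempty) : RelComplex n where
  K := SimplicialCpx.simplex n
  L := K
  le _ _ := SimplicialCpx.mem_simplex _
  nonempty := hK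

/-- The member of the pair `(K, L)` selected by a Boolean: `K` for `true`, `L` for `false`. -/
def side (P : RelComplex n) : Bool → SimplicialCpx n
  | true => P.K
  | false => P.L

theorem mem_side_act (P : RelComplex n) (σ : Equiv.Perm (Fin n)) (s : Bool) {I : Finset (Fin n)}
    (hI : I ∈ (P.act σ).side s) : I.map σ.toEmbedding ∈ P.side s := by
  cases s with
  | true => exact hI
  | false => exact hI

end RelComplex

/-- The simplicial join operad on the relative simplicial complexes `(K, L)` with `L ≠ ∅`. -/
def joinOperad : SetOperad.{0} where
  Op := RelComplex
  act := RelComplex.act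
  comp := RelComplex.comp
  one := RelComplex.unit
  act_one A := by
    ext I <;> simp [RelComplex.act, Equiv.Perm.one_def]
  act_mul A σ τ := by
    ext I <;>
    simp [RelComplex.act, Finset.map_map, Function.Embedding.trans, Equiv.toEmbedding, Function.comp_def]
  one_comp h A := RelComplex.ext (SimplicialCpx.pt_joinAction h A.K A.L A.le)
    (SimplicialCpx.trivial_joinAction h A.K A.L)
  comp_one h k A := RelComplex.ext (SimplicialCpx.joinAction_trivial_pt h k A.K)
    (SimplicialCpx.joinAction_trivial_pt h k A.L)
  comp_sequential h₁ h₂ h₃ h₄ i j A B C :=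
    RelComplex.ext (SimplicialCpx.joinAction_sequential h₁ h₂ h₃ h₄ i j A.K B.K B.L C.K C.L)
      (SimplicialCpx.joinAction_sequential h₁ h₂ h₃ h₄ i j A.L B.K B.L C.K C.L)
  comp_parallel h₁ h₂ h₃ h₄ i j hij A B C :=
    RelComplex.ext (SimplicialCpx.joinAction_parallel h₁ h₂ h₃ h₄ i j hij.ne A.K B.K B.L C.K C.L)
      (SimplicialCpx.joinAction_parallel h₁ h₂ h₃ h₄ i j hij.ne A.L B.K B.L C.K C.L)
  comp_equivariant h k A B σ τ :=
    RelComplex.ext (SimplicialCpx.joinAction_equivariant h k A.K B.K B.L σ τ)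
      (SimplicialCpx.joinAction_equivariant h k A.L B.K B.L σ τ)

/-! ### Finite tensor products and their canonical maps -/

section Tensor

variable {C : Type u} [Category.{v} C] [MonoidalCategory C]

/-- The tensor product `X₁ ⊗ (X₂ ⊗ (⋯ ⊗ (Xₙ ⊗ e)))` of a finite sequence of objects. -/
def tens : {n : ℕ} → (Fin n → C) → C
  | 0, _ => 𝟙_ C
  | _ + 1, X => X 0 ⊗ tens fun i => X i.succ

/-- The tensor product of a finite sequence of morphisms. -/
def tensMap : {n : ℕ} → {X Y : Fin n → C} → (∀ i, X i ⟶ Y i) → (tens X ⟶ tens Y)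
  | 0, _, _, _ => 𝟙 _
  | _ + 1, _, _, a => a 0 ⊗ₘ tensMap fun i => a i.succ

theorem tensMap_id : ∀ {n : ℕ} (X : Fin n → C), tensMap (fun i => 𝟙 (X i)) = 𝟙 (tens X)
  | 0, _ => rfl
  | _ + 1, X => by
    rw [tensMap, tensMap_id fun i => X i.succ]
    exact id_tensorHom_id _ _

theorem tensMap_comp : ∀ {n : ℕ} {X Y Z : Fin n → C} (a : ∀ i, X i ⟶ Y i) (b : ∀ i, Y i ⟶ Z i),
    tensMap (fun i => a i ≫ b i) = tensMap a ≫ tensMap b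
  | 0, _, _, _, _, _ => (Category.comp_id _).symm
  | _ + 1, _, _, _, a, b => by
    rw [tensMap, tensMap_comp (fun i => a i.succ) fun i => b i.succ]
    exact (tensorHom_comp_tensorHom _ _ _ _).symm

/-- The canonical map `⨂_{q < n + m} X_q ⟶ (⨂_{i < n} Yᵢ) ⊗ (⨂_{j < m} Zⱼ)` which applies the given
maps to the factors, and rebrackets. -/
def splitMap : {n m p : ℕ} → (h : p = n + m) → {X : Fin p → C} → {Y : Fin n → C} → {Z : Fin m → C} →
    (a : ∀ (i : Fin n) (q : Fin p), (q : ℕ) = i → (X q ⟶ Y i)) →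
    (b : ∀ (j : Fin m) (q : Fin p), (q : ℕ) = n + j → (X q ⟶ Z j)) →
    (tens X ⟶ tens Y ⊗ tens Z)
  | 0, m, p, h, X, Y, Z, _, b =>
    have h' : p = m := by omega
    match p, h', X, b with
    | _, rfl, _, b => tensMap (fun j => b j j (by omega)) ≫ (λ_ _).inv
  | n + 1, m, 0, h, _, _, _, _, _ => absurd h (by omega)
  | n + 1, m, p + 1, h, X, Y, Z, a, b =>
    (a 0 0 rfl ⊗ₘ splitMap (n := n) (m := m) (p := p) (by omega)
      (X := fun q => X q.succ) (Y := fun i => Y i.succ) (Z := Z)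
      (fun i q hq => a i.succ q.succ (by simp [hq]))
      (fun j q hq => b j q.succ (by simp [hq]; omega))) ≫ (α_ _ _ _).inv

/-- The canonical map `⨂_q X_q ⟶ ⨂ᵢ Yᵢ` from a tensor product of `p = n + m - 1` factors to a tensor
product of `n` factors, which applies the given maps `aL` and `aR` to the factors before and after
the block of `m` factors starting at `k`, the given maps `c : X_{k+j} ⟶ Wⱼ` to the factors of the
block, which groups the block into `⨂ⱼ Wⱼ`, and which then applies the given map
`b : ⨂ⱼ Wⱼ ⟶ Yₖ`. -/
def blockMap : {n m p : ℕ} → (h : p + 1 = n + m) → (k : Fin n) →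
    {X : Fin p → C} → {Y : Fin n → C} → {W : Fin m → C} →
    (aL : ∀ (i : Fin n) (q : Fin p), (i : ℕ) < k → (q : ℕ) = i → (X q ⟶ Y i)) →
    (c : ∀ (j : Fin m) (q : Fin p), (q : ℕ) = k + j → (X q ⟶ W j)) →
    (aR : ∀ (i : Fin n) (q : Fin p), (k : ℕ) < i → (q : ℕ) + 1 = i + m → (X q ⟶ Y i)) →
    (b : tens W ⟶ Y k) → (tens X ⟶ tens Y)
  | n + 1, m, p, h, ⟨0, _⟩, _, Y, _, _, c, aR, b =>
    splitMap (n := m) (m := n) (p := p) (by omega) (Z := fun i => Y i.succ)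
      (fun j q hq => c j q (by simpa using hq))
      (fun i q hq => aR i.succ q (by simp) (by simp [hq]; omega)) ≫ (b ▷ _)
  | n + 1, m, 0, h, ⟨k + 1, hk⟩, _, _, _, _, _, _, _ => absurd h (by omega)
  | n + 1, m, p + 1, h, ⟨k + 1, hk⟩, X, Y, W, aL, c, aR, b =>
    aL 0 0 (by simp) rfl ⊗ₘ
      blockMap (n := n) (m := m) (p := p) (by omega) ⟨k, by omega⟩
        (X := fun q => X q.succ) (Y := fun i => Y i.succ) (W := W)
        (fun i q hi hq => aL i.succ q.succ (by simpa using hi) (by simpa using hq))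
        (fun j q hq => c j q.succ (by simp at hq ⊢; omega))
        (fun i q hi hq => aR i.succ q.succ (by simpa using hi) (by simp; omega))
        b

variable [SymmetricCategory C]

/-- The canonical map `A ⊗ (⨂ᵢ Zᵢ) ⟶ ⨂ⱼ Yⱼ` which moves the factor `A` to the slot `k`, past the first
factors of the tensor product, and applies the given maps `A ⟶ Yₖ` and `Zᵢ ⟶ Yⱼ` to the factors, where
`j` is the `i`-th element of `Fin (n + 1)` different from `k`. -/
def moveMap : {n : ℕ} → (k : Fin (n + 1)) → {A : C} → {Z : Fin n → C} → {Y : Fin (n + 1) → C} →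
    (a : A ⟶ Y k) →
    (b : ∀ (i : Fin n) (j : Fin (n + 1)), j = k.succAbove i → (Z i ⟶ Y j)) →
    (A ⊗ tens Z ⟶ tens Y)
  | _, ⟨0, _⟩, _, _, _, a, b => a ⊗ₘ tensMap fun i => b i i.succ (by simp)
  | 0, ⟨k + 1, hk⟩, _, _, _, _, _ => absurd hk (by omega)
  | n + 1, ⟨k + 1, hk⟩, A, Z, Y, a, b =>
    (α_ A (Z 0) _).inv ≫ ((β_ A (Z 0)).hom ▷ _) ≫ (α_ (Z 0) A _).hom ≫
      (b 0 0 (by simp [Fin.succAbove, Fin.lt_def]) ⊗ₘ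
        moveMap (n := n) ⟨k, by omega⟩ (A := A) (Z := fun i => Z i.succ) (Y := fun j => Y j.succ) a
          (fun i j hj => b i.succ j.succ (by
            subst hj
            exact (Fin.succ_succAbove_succ ⟨k, by omega⟩ i).symm)))

/-- The permutation induced by `σ` between the complements of `0` and of `σ 0`, both of them being
identified with `Fin n` in the increasing way. -/
def permTail {n : ℕ} (σ : Equiv.Perm (Fin (n + 1))) : Equiv.Perm (Fin n) :=
  ((finSuccAboveEquiv 0).trans
    (σ.subtypeEquiv (fun i => (σ.injective.ne_iff (x := i) (y := 0)).symm))).trans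
    (finSuccAboveEquiv (σ 0)).symm

theorem succAbove_permTail {n : ℕ} (σ : Equiv.Perm (Fin (n + 1))) (i : Fin n) :
    (σ 0).succAbove (permTail σ i) = σ i.succ := by
  have h := congrArg Subtype.val ((finSuccAboveEquiv (σ 0)).apply_symm_apply
    ((σ.subtypeEquiv (fun i => (σ.injective.ne_iff (x := i) (y := 0)).symm))
      (finSuccAboveEquiv 0 i)))
  exact h

/-- The canonical map `⨂ᵢ Xᵢ ⟶ ⨂ⱼ Yⱼ` which permutes the factors by means of the symmetry of `C`, the
`i`-th factor going to the slot `σ i`, and applies the given maps `Xᵢ ⟶ Y_{σ i}` to them. -/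
def permMap : {n : ℕ} → (σ : Equiv.Perm (Fin n)) → {X Y : Fin n → C} →
    (a : ∀ i j : Fin n, j = σ i → (X i ⟶ Y j)) → (tens X ⟶ tens Y)
  | 0, _, _, _, _ => 𝟙 _
  | n + 1, σ, X, Y, a =>
    (X 0 ◁ permMap (n := n) (permTail σ) (Y := fun i => Y ((σ 0).succAbove i))
      (fun i j hj => a i.succ ((σ 0).succAbove j) (by rw [hj, succAbove_permTail]))) ≫
      moveMap (σ 0) (a 0 (σ 0) rfl) (fun i j hj => eqToHom (by rw [hj]))

end Tensor

/-! ### The cubical functor and the structure maps -/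

section StructureMaps

variable {C : Type u} [Category.{v} C]

/-- The end of an arrow `f : Y ⟶ X` selected by a Boolean: `X` for `true` and `Y` for `false`. -/
def vertex (f : Arrow C) : Bool → C
  | true => f.right
  | false => f.left

/-- The map between ends of an arrow `f`, for `a ≤ b`: an identity, or `f` itself. -/
def edge (f : Arrow C) : {a b : Bool} → a ≤ b → (vertex f a ⟶ vertex f b)
  | true, true, _ => 𝟙 _
  | false, true, _ => f.hom
  | false, false, _ => 𝟙 _
  | true, false, h => absurd h (by decide)

theorem edge_refl (f : Arrow C) : ∀ {a : Bool} (h : a ≤ a), edge f h = 𝟙 _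
  | true, _ => rfl
  | false, _ => rfl

theorem edge_comp (f : Arrow C) : ∀ {a b c : Bool} (h : a ≤ b) (h' : b ≤ c),
    edge f (h.trans h') = edge f h ≫ edge f h'
  | true, true, true, _, _ => (Category.comp_id _).symm
  | false, true, true, _, _ => (Category.comp_id _).symm
  | false, false, true, _, _ => (Category.id_comp _).symm
  | false, false, false, _, _ => (Category.comp_id _).symm
  | true, false, _, h, _ => absurd h (by decide)
  | _, true, false, _, h => absurd h (by decide)

/-- The component of a morphism of arrows at one of the two ends. -/
def vertexMap {f g : Arrow C} (e : f ⟶ g) : (s : Bool) → (vertex f s ⟶ vertex g s)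
  | true => e.right
  | false => e.left

theorem decide_mem_mono {n : ℕ} {I J : Finset (Fin n)} (h : I ≤ J) (i : Fin n) :
    decide (i ∈ I) ≤ decide (i ∈ J) := fun hI => by
  simp only [decide_eq_true_eq] at hI ⊢
  exact h hI

variable [MonoidalCategory C]

/-- The cubical functor `zₙ(-; f)` of a sequence `f` of arrows `fᵢ : Yᵢ ⟶ Xᵢ`: it sends `I` to the tensor
product of the `Xᵢ`, `i ∈ I`, and the `Yᵢ`, `i ∉ I`, and an inclusion `I ⊆ J` to the tensor product of
the `fᵢ`, `i ∈ J \ I`, and identities. -/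
def cubical {n : ℕ} (f : Fin n → Arrow C) : Finset (Fin n) ⥤ C where
  obj I := tens fun i => vertex (f i) (decide (i ∈ I))
  map u := tensMap fun i => edge (f i) (decide_mem_mono (leOfHom u) i)
  map_id I := by simp only [edge_refl]; exact tensMap_id _
  map_comp u u' := by
    rw [← tensMap_comp]
    congr 1
    funext i
    exact edge_comp (f i) (decide_mem_mono (leOfHom u) i) (decide_mem_mono (leOfHom u') i)

/-- The face category `cat(K)` of a simplicial complex, as a full subcategory of the Boolean lattice.
(The complexes considered below are nonempty, so that `∅` is one of the faces.) -/
abbrev FaceCat {n : ℕ} (K : SimplicialCpx n) : Type := {I : Finset (Fin n) // I ∈ K}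

noncomputable instance {n : ℕ} (K : SimplicialCpx n) : Fintype (FaceCat K) := Fintype.ofFinite _

/-- The inclusion of the face category in the Boolean lattice. -/
def faceIncl {n : ℕ} (K : SimplicialCpx n) : FaceCat K ⥤ Finset (Fin n) :=
  Monotone.functor (f := fun I : FaceCat K => I.1) fun _ _ h => h

/-- The inclusion `cat(L) ⥤ cat(K)` for a subcomplex `L` of `K`. -/
def faceCatIncl {n : ℕ} {L K : SimplicialCpx n} (h : L ≤ K) : FaceCat L ⥤ FaceCat K :=
  Monotone.functor (f := fun I : FaceCat L => (⟨I.1, h I.2⟩ : FaceCat K)) fun _ _ h => h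

/-- The diagram `zₙ(-; f) : cat(K) ⥤ C`. -/
abbrev diagram {n : ℕ} (K : SimplicialCpx n) (f : Fin n → Arrow C) : FaceCat K ⥤ C :=
  faceIncl K ⋙ cubical f

variable [HasFiniteColimits C]

/-- The colimit over `cat(K)` of `zₙ(-; f)`. -/
noncomputable abbrev polyhedral {n : ℕ} (K : SimplicialCpx n) (f : Fin n → Arrow C) : C :=
  colimit (diagram K f)

/-- The coprojection `zₙ(I; f) ⟶ colim_{cat(K)} zₙ(-; f)` of a face `I` of `K`. -/
noncomputable def polyhedralι {n : ℕ} (K : SimplicialCpx n) (f : Fin n → Arrow C) (I : Finset (Fin n))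
    (hI : I ∈ K) : (cubical f).obj I ⟶ polyhedral K f :=
  colimit.ι (diagram K f) ⟨I, hI⟩

/-- The canonical morphism `colim_{cat(L)} zₙ(-; f) ⟶ colim_{cat(K)} zₙ(-; f)` induced by the
inclusion `cat(L) ⥤ cat(K)`. -/
noncomputable def polyhedralMap {n : ℕ} {L K : SimplicialCpx n} (h : L ≤ K) (f : Fin n → Arrow C) :
    polyhedral L f ⟶ polyhedral K f :=
  colimit.pre (diagram K f) (faceCatIncl h)

/-- The arrow `Mₙ((K, L); f)`, that is, the canonical morphism
`colim_{cat(L)} zₙ(-; f) ⟶ colim_{cat(K)} zₙ(-; f)`. -/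
noncomputable def joinMap {n : ℕ} (P : RelComplex n) (f : Fin n → Arrow C) : Arrow C :=
  Arrow.mk (polyhedralMap P.le f)

/-- The coprojections of the two colimits which are the ends of the arrow `Mₙ((K, L); f)`. -/
noncomputable def joinι {n : ℕ} (P : RelComplex n) (f : Fin n → Arrow C) :
    (s : Bool) → (I : Finset (Fin n)) → I ∈ P.side s →
      ((cubical f).obj I ⟶ vertex (joinMap P f) s)
  | true, I, hI => polyhedralι P.K f I hI
  | false, I, hI => polyhedralι P.L f I hI

/-- The substitution polyhedral product map: the coprojection
`zₙ(∅; f) ⟶ colim_{cat(K)} zₙ(-; f)`, for `K` nonempty. -/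
noncomputable def substMap {n : ℕ} (K : SimplicialCpx n) (hK : (K : Set (Finset (Fin n))).Nonempty)
    (f : Fin n → Arrow C) : Arrow C :=
  Arrow.mk (polyhedralι K f ∅ (SimplicialCpx.empty_mem hK))

/-- The composition polyhedral product map: the canonical morphism
`colim_{cat(K)} zₙ(-; f) ⟶ zₙ([n]; f)`. -/
noncomputable def compoMap {n : ℕ} (K : SimplicialCpx n) (f : Fin n → Arrow C) : Arrow C :=
  Arrow.mk (colimit.desc (diagram K f)
    { pt := (cubical f).obj Finset.univ
      ι := { app := fun I => (cubical f).map (homOfLE (Finset.subset_univ I.1))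
             naturality := fun I J u => by
               refine ((cubical f).map_comp ((faceIncl K).map u) _).symm.trans (Eq.trans ?_ (Category.comp_id _).symm)
               exact congrArg (cubical f).map (Subsingleton.elim _ _) } })

end StructureMaps

/-! ### The canonical maps between values of the cubical functor -/

section CanonicalMaps

variable {C : Type u} [Category.{v} C] [MonoidalCategory C]

/-- The canonical map `z₁(I; f) ⟶ Y` or `X`, for `f : Y ⟶ X`: it is the map of `f` from the end
selected by `I` to the end selected by `s`, up to the unit isomorphism. -/
def unitFaceMap (f : Fin 1 → Arrow C) (s : Bool) (I : Finset (Fin 1))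
    (hI : I ∈ RelComplex.unit.side s) : (cubical f).obj I ⟶ vertex (f 0) s :=
  (ρ_ (vertex (f 0) (decide ((0 : Fin 1) ∈ I)))).hom ≫ edge (f 0) (by
    cases s with
    | true => exact Bool.le_true _
    | false =>
      have h : I = ∅ := (SimplicialCpx.mem_trivial I).1 hI
      simp [h])

/-- The canonical isomorphism `zₙ(I; f) ≅ zₙ(σ(I); f ∘ σ⁻¹)` permuting the factors. -/
def permFaceMap [SymmetricCategory C] {n : ℕ} (σ : Equiv.Perm (Fin n)) (f : Fin n → Arrow C)
    (I : Finset (Fin n)) :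
    (cubical f).obj I ⟶ (cubical (f ∘ σ.symm)).obj (I.map σ.toEmbedding) :=
  permMap σ fun i j hj => eqToHom (by subst hj; simp)

/-- The set of positions whose part outside the inserted block is `I \ {k}`, and whose part inside
the block is `J`. -/
def joinFace {n m p : ℕ} (h : p + 1 = n + m) (k : Fin n) (I : Finset (Fin n)) (J : Finset (Fin m)) :
    Finset (Fin p) :=
  Finset.univ.filter fun q =>
    (∃ i ∈ I, ∃ hi : i ≠ k, outerPos h k i hi = q) ∨ ∃ j ∈ J, innerPos h k j = q

theorem outer_mem_joinFace {n m p : ℕ} (h : p + 1 = n + m) (k : Fin n) (I : Finset (Fin n))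
    (J : Finset (Fin m)) (i : Fin n) (hi : i ≠ k) : outerPos h k i hi ∈ joinFace h k I J ↔ i ∈ I := by
  have hinj := (position_bijective h k).1
  simp only [joinFace, Finset.mem_filter, Finset.mem_univ, true_and]
  constructor
  · rintro (⟨i', hi', hik, he⟩ | ⟨j, _, he⟩)
    · have := @hinj (Sum.inl ⟨i', hik⟩) (Sum.inl ⟨i, hi⟩) he
      simp only [Sum.inl.injEq, Subtype.mk.injEq] at this
      exact this ▸ hi'
    · exact absurd (@hinj (Sum.inr j) (Sum.inl ⟨i, hi⟩) he) (by simp)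
  · exact fun hI => Or.inl ⟨i, hI, hi, rfl⟩

theorem inner_mem_joinFace {n m p : ℕ} (h : p + 1 = n + m) (k : Fin n) (I : Finset (Fin n))
    (J : Finset (Fin m)) (j : Fin m) : innerPos h k j ∈ joinFace h k I J ↔ j ∈ J := by
  have hinj := (position_bijective h k).1
  simp only [joinFace, Finset.mem_filter, Finset.mem_univ, true_and]
  constructor
  · rintro (⟨i, _, hik, he⟩ | ⟨j', hj', he⟩)
    · exact absurd (@hinj (Sum.inl ⟨i, hik⟩) (Sum.inr j) he) (by simp)
    · have := @hinj (Sum.inr j') (Sum.inr j) he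
      simp only [Sum.inr.injEq] at this
      exact this ▸ hj'
  · exact fun hJ => Or.inr ⟨j, hJ, rfl⟩

/-- `joinFace h k I J` is a face of the join composition when `I` is a face of the first complex and
`J` a face of the complex that `I` selects at the slot `k`. -/
theorem joinFace_mem {n m p : ℕ} (h : p + 1 = n + m) (k : Fin n) (P : RelComplex n)
    (Q : RelComplex m) (s : Bool) {I : Finset (Fin n)} {J : Finset (Fin m)} (hI : I ∈ P.side s)
    (hJ : J ∈ Q.side (decide (k ∈ I))) : joinFace h k I J ∈ (P.comp h k Q).side s := by
  have key : ∀ K : SimplicialCpx n, I ∈ K → joinFace h k I J ∈ SimplicialCpx.joinAction h k K Q.K Q.L := by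
    intro K hK
    refine ⟨I, hK, fun i hi hS => (outer_mem_joinFace h k I J i hi).1 hS, ?_⟩
    have : SimplicialCpx.innerPart h k (joinFace h k I J) = J := by
      ext j
      rw [SimplicialCpx.mem_innerPart, inner_mem_joinFace]
    rw [this]
    by_cases hk : k ∈ I
    · simpa [hk, RelComplex.side] using hJ
    · simpa [hk, RelComplex.side] using hJ
  cases s with
  | true => exact key P.K hI
  | false => exact key P.L hI

/-- Given an arrow `g` and a map `b` from `zₘ(J; fₖ, …, fₖ₊ₘ₋₁)` to the end of `g` selected by whether
`k ∈ I`, the canonical map `zₚ(joinFace I J; f) ⟶ zₙ(I; f₁, …, fₖ₋₁, g, fₖ₊ₘ, …)` which groups the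
block of `m` factors and applies `b` to it. -/
def compFaceMap {n m p : ℕ} (h : p + 1 = n + m) (k : Fin n) (f : Fin p → Arrow C) (g : Arrow C)
    (I : Finset (Fin n)) (J : Finset (Fin m))
    (b : (cubical fun j => f (innerPos h k j)).obj J ⟶ vertex g (decide (k ∈ I))) :
    (cubical f).obj (joinFace h k I J) ⟶ (cubical (insertAt h k f g)).obj I :=
  blockMap h k
    (fun i q hi hq => eqToHom (by
      have hik : i ≠ k := fun he => by simp [he] at hi
      obtain rfl : outerPos h k i hik = q := by rw [outer_eq_iff]; omega
      simp only [insertAt_of_ne h hik, outer_mem_joinFace]))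
    (fun j q hq => eqToHom (by
      obtain rfl : innerPos h k j = q := by rw [inner_eq_iff]; omega
      simp only [inner_mem_joinFace]))
    (fun i q hi hq => eqToHom (by
      have hik : i ≠ k := fun he => by simp [he] at hi
      obtain rfl : outerPos h k i hik = q := by rw [outer_eq_iff]; omega
      simp only [insertAt_of_ne h hik, outer_mem_joinFace]))
    (b ≫ eqToHom (by rw [insertAt_self]))

end CanonicalMaps

end JoinOperad

open JoinOperad

/-!
Everything rests on the universal property of the ends of `joinMap P f`: a map out of the end `s` is a
compatible family of maps out of the `zₙ(I; f)`, for `I` a face of the member `s` of `P`. By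
`existsUnique_joinIso`, a compatible family of maps `zₙ(I; f) ⟶ G` into the two ends of an arrow `G` is
induced by a unique isomorphism `joinMap P f ≅ G` once these maps are jointly epic and the coprojections
factor through them. For the unit, each end is the value at a greatest face. For the symmetric group
actions, the diagrams are naturally isomorphic over isomorphic posets of faces
(`existsUnique_joinIso_of_orderIso`); the same argument shows that `joinMap P` preserves isomorphisms.

For the partial compositions, fix a face `I` of `P`. The value at `I` of the cubical functor of
`f₁, …, fₖ₋₁, joinMap Q (fₖ, …), fₖ₊ₘ, …` is obtained from an end of `joinMap Q (fₖ, …)`, a colimit over the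
faces `J` of a member of `Q`, by tensoring with fixed objects on both sides, that is, by applying
`slotFunctor`. Tensoring preserves finite colimits, so this value is the colimit over `J` of the
`zₚ(joinFace I J; f)` (`compFaceMap_hom_ext`, `exists_compFaceMap_desc`). Hence maps out of the iterated
colimit are families of maps out of the `zₚ(joinFace I J; f)`, natural in `I` and `J`. They are the same as
compatible families indexed by the faces of the composite `P ∘ₖ Q`, since every such face is of the form
`joinFace I J`, and since the possible choices of `(I, J)` are compared through their intersection
(`map_comp_compι_eq`).

The canonical maps between tensor products are defined by recursion on the number of factors; their
naturality and invertibility are proved along the same recursion.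
-/

namespace JoinOperad

/-! ### Naturality and invertibility of the canonical maps of tensor products -/

section Tensor

variable {C : Type u} [Category.{v} C] [MonoidalCategory C]

theorem isIso_tensMap : ∀ {n : ℕ} {X Y : Fin n → C} (a : ∀ i, X i ⟶ Y i), (∀ i, IsIso (a i)) →
    IsIso (tensMap a)
  | 0, _, _, _, _ => inferInstanceAs (IsIso (𝟙 _))
  | _ + 1, _, _, a, ha =>
    @tensor_isIso _ _ _ _ _ _ _ (a 0) (ha 0) _ (isIso_tensMap (fun i => a i.succ) fun i => ha i.succ)

/-- A commutative square stays so when the right-hand objects are tensored with the unit. The lemmas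
up to `tensorHom_comp_comp` are the inductive steps of the naturality statements below; they are stated
for arbitrary objects because `tens X` and `X 0 ⊗ tens fun i => X i.succ` agree only after unfolding. -/
theorem comp_leftUnitor_inv_square {A A' B B' : C} {u : A ⟶ A'} {b : A ⟶ B} {b' : A' ⟶ B'}
    {z : B ⟶ B'} (h : u ≫ b' = b ≫ z) :
    u ≫ b' ≫ (λ_ B').inv = (b ≫ (λ_ B).inv) ≫ (𝟙 (𝟙_ C) ⊗ₘ z) := by
  rw [reassoc_of% h]
  simp

theorem tensorHom_comp_associator_inv_square {A A' S S' Y Y' T T' Z Z' : C} {x : A ⟶ A'}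
    {s : S ⟶ S'} {a : A ⟶ Y} {a' : A' ⟶ Y'} {y : Y ⟶ Y'} {t : S ⟶ T ⊗ Z} {t' : S' ⟶ T' ⊗ Z'}
    {c : T ⟶ T'} {z : Z ⟶ Z'} (h : x ≫ a' = a ≫ y) (h' : s ≫ t' = t ≫ (c ⊗ₘ z)) :
    (x ⊗ₘ s) ≫ (a' ⊗ₘ t') ≫ (α_ Y' T' Z').inv =
      ((a ⊗ₘ t) ≫ (α_ Y T Z).inv) ≫ ((y ⊗ₘ c) ⊗ₘ z) := by
  rw [tensorHom_comp_tensorHom_assoc, h, h', Category.assoc, ← associator_inv_naturality,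
    tensorHom_comp_tensorHom_assoc]

theorem tensorHom_comp_square {A A' B B' D D' E E' : C} {x : A ⟶ A'} {y : B ⟶ B'} {a : A ⟶ D}
    {a' : A' ⟶ D'} {b : B ⟶ E} {b' : B' ⟶ E'} {d : D ⟶ D'} {e : E ⟶ E'} (h : x ≫ a' = a ≫ d)
    (h' : y ≫ b' = b ≫ e) : (x ⊗ₘ y) ≫ (a' ⊗ₘ b') = (a ⊗ₘ b) ≫ (d ⊗ₘ e) := by
  rw [tensorHom_comp_tensorHom, h, h', tensorHom_comp_tensorHom]

theorem tensorHom_comp_whiskerLeft_square {A A' B B' D E E' : C} {x : A ⟶ A'} {y : B ⟶ B'}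
    {a : A ⟶ D} {a' : A' ⟶ D} {b : B ⟶ E} {b' : B' ⟶ E'} {e : E ⟶ E'} (h : x ≫ a' = a)
    (h' : y ≫ b' = b ≫ e) : (x ⊗ₘ y) ≫ (a' ⊗ₘ b') = (a ⊗ₘ b) ≫ D ◁ e := by
  rw [tensorHom_comp_tensorHom, h, h', tensorHom_comp_whiskerLeft]

theorem comp_whiskerRight_square {X X' V V' T T' B B' : C} {x : X ⟶ X'} {s : X ⟶ V ⊗ T}
    {s' : X' ⟶ V' ⊗ T'} {w : V ⟶ V'} {t : T ⟶ T'} {b : V ⟶ B} {b' : V' ⟶ B'} {y : B ⟶ B'}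
    (h : x ≫ s' = s ≫ (w ⊗ₘ t)) (h' : w ≫ b' = b ≫ y) :
    x ≫ s' ≫ b' ▷ T' = (s ≫ b ▷ T) ≫ (y ⊗ₘ t) := by
  rw [reassoc_of% h, tensorHom_comp_whiskerRight, h', Category.assoc, whiskerRight_comp_tensorHom]

theorem whiskerLeft_comp_square {A A' S S' T T' Y Y' : C} {x : A ⟶ A'} {s : S ⟶ S'} {e : S ⟶ T}
    {e' : S' ⟶ T'} {t : T ⟶ T'} {r : A ⊗ T ⟶ Y} {r' : A' ⊗ T' ⟶ Y'} {y : Y ⟶ Y'}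
    (h : s ≫ e' = e ≫ t) (h' : (x ⊗ₘ t) ≫ r' = r ≫ y) :
    (x ⊗ₘ s) ≫ A' ◁ e' ≫ r' = (A ◁ e ≫ r) ≫ y := by
  rw [tensorHom_comp_whiskerLeft_assoc, h, Category.assoc, ← h', whiskerLeft_comp_tensorHom_assoc]

theorem tensorHom_comp_comp {A B D E F G : C} (u : A ⟶ B) (v : D ⟶ E) (w : E ⟶ F) (t : F ⟶ G) :
    (u ⊗ₘ (v ≫ w ≫ t)) = (u ⊗ₘ v) ≫ B ◁ w ≫ B ◁ t := by
  rw [← whiskerLeft_comp, tensorHom_comp_whiskerLeft]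

theorem splitMap_zero {m : ℕ} (h : m = 0 + m) {X : Fin m → C} {Y : Fin 0 → C} {Z : Fin m → C}
    (a : ∀ (i : Fin 0) (q : Fin m), (q : ℕ) = i → (X q ⟶ Y i))
    (b : ∀ (j : Fin m) (q : Fin m), (q : ℕ) = 0 + j → (X q ⟶ Z j)) :
    splitMap h a b = tensMap (fun j => b j j (Nat.zero_add _).symm) ≫ (λ_ _).inv := rfl

theorem isIso_splitMap : ∀ {n m p : ℕ} (h : p = n + m) {X : Fin p → C} {Y : Fin n → C}
    {Z : Fin m → C} (a : ∀ (i : Fin n) (q : Fin p), (q : ℕ) = i → (X q ⟶ Y i))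
    (b : ∀ (j : Fin m) (q : Fin p), (q : ℕ) = n + j → (X q ⟶ Z j)),
    (∀ i q hq, IsIso (a i q hq)) → (∀ j q hq, IsIso (b j q hq)) → IsIso (splitMap h a b)
  | 0, m, p, h, X, Y, Z, a, b, _, hb => by
    obtain rfl : p = m := by omega
    rw [splitMap_zero]
    exact @IsIso.comp_isIso _ _ _ _ _ _ _ (isIso_tensMap _ fun j => hb _ _ _) (Iso.isIso_inv (λ_ _))
  | n + 1, m, 0, h, _, _, _, _, _, _, _ => absurd h (by omega)
  | n + 1, m, p + 1, h, X, Y, Z, a, b, ha, hb => by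
    rw [splitMap]
    exact @IsIso.comp_isIso _ _ _ _ _ _ _ (@tensor_isIso _ _ _ _ _ _ _ _ (ha 0 0 rfl) _
      (isIso_splitMap (n := n) (m := m) (p := p) _ _ _ (fun _ _ _ => ha _ _ _)
        (fun _ _ _ => hb _ _ _))) (Iso.isIso_inv (α_ _ _ _))

theorem splitMap_naturality : ∀ {n m p : ℕ} (h : p = n + m) {X X' : Fin p → C} {Y Y' : Fin n → C}
    {Z Z' : Fin m → C} {a : ∀ (i : Fin n) (q : Fin p), (q : ℕ) = i → (X q ⟶ Y i)}
    {b : ∀ (j : Fin m) (q : Fin p), (q : ℕ) = n + j → (X q ⟶ Z j)}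
    {a' : ∀ (i : Fin n) (q : Fin p), (q : ℕ) = i → (X' q ⟶ Y' i)}
    {b' : ∀ (j : Fin m) (q : Fin p), (q : ℕ) = n + j → (X' q ⟶ Z' j)}
    (x : ∀ q, X q ⟶ X' q) (y : ∀ i, Y i ⟶ Y' i) (z : ∀ j, Z j ⟶ Z' j),
    (∀ i q hq, x q ≫ a' i q hq = a i q hq ≫ y i) →
    (∀ j q hq, x q ≫ b' j q hq = b j q hq ≫ z j) →
    tensMap x ≫ splitMap h a' b' = splitMap h a b ≫ (tensMap y ⊗ₘ tensMap z)
  | 0, m, p, h, X, X', Y, Y', Z, Z', a, b, a', b', x, y, z, _, hb => by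
    obtain rfl : p = m := by omega
    refine comp_leftUnitor_inv_square ?_
    rw [← tensMap_comp, ← tensMap_comp]
    simp only [hb]
  | n + 1, m, 0, h, _, _, _, _, _, _, _, _, _, _, _, _, _, _, _ => absurd h (by omega)
  | n + 1, m, p + 1, h, X, X', Y, Y', Z, Z', a, b, a', b', x, y, z, ha, hb => by
    have ih := splitMap_naturality (n := n) (m := m) (p := p) (by omega)
      (a := fun i q hq => a i.succ q.succ (by simp [hq]))
      (b := fun j q hq => b j q.succ (by simp [hq]; omega))
      (a' := fun i q hq => a' i.succ q.succ (by simp [hq]))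
      (b' := fun j q hq => b' j q.succ (by simp [hq]; omega))
      (fun q => x q.succ) (fun i => y i.succ) z
      (fun i q hq => ha _ _ _) (fun j q hq => hb _ _ _)
    exact tensorHom_comp_associator_inv_square (ha 0 0 rfl) ih

/-- The functor `W ↦ Y₁ ⊗ (⋯ ⊗ (W ⊗ (⋯ ⊗ (Yₙ ⊗ e))))`, with `W` in the slot `k` in place of `Yₖ`. -/
def slotFunctor : {n : ℕ} → (k : Fin n) → (Y : Fin n → C) → C ⥤ C
  | _ + 1, ⟨0, _⟩, Y => tensorRight (tens fun i => Y i.succ)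
  | _ + 1, ⟨k + 1, hk⟩, Y =>
    slotFunctor ⟨k, Nat.lt_of_succ_lt_succ hk⟩ (fun i => Y i.succ) ⋙ tensorLeft (Y 0)

/-- Putting `Yₖ` itself in the slot `k` gives the tensor product of the `Yᵢ`. -/
def slotIso : {n : ℕ} → (k : Fin n) → (Y : Fin n → C) → ((slotFunctor k Y).obj (Y k) ≅ tens Y)
  | _ + 1, ⟨0, _⟩, _ => Iso.refl _
  | _ + 1, ⟨k + 1, hk⟩, Y =>
    whiskerLeftIso (Y 0) (slotIso ⟨k, Nat.lt_of_succ_lt_succ hk⟩ fun i => Y i.succ)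

theorem preservesFiniteColimits_slotFunctor [∀ X : C, PreservesFiniteColimits (tensorLeft X)]
    [∀ X : C, PreservesFiniteColimits (tensorRight X)] : ∀ {n : ℕ} (k : Fin n) (Y : Fin n → C),
    PreservesFiniteColimits (slotFunctor k Y)
  | _ + 1, ⟨0, _⟩, Y => by rw [slotFunctor]; infer_instance
  | _ + 1, ⟨k + 1, hk⟩, Y => by
    have := preservesFiniteColimits_slotFunctor ⟨k, Nat.lt_of_succ_lt_succ hk⟩ fun i => Y i.succ
    rw [slotFunctor]
    exact comp_preservesFiniteColimits _ _

/-- The part of `blockMap` which precedes the map `b : ⨂ⱼ Wⱼ ⟶ Yₖ`: it groups the block of `m` factors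
starting at `k` into `⨂ⱼ Wⱼ`, in the slot `k`. -/
def groupMap : {n m p : ℕ} → (h : p + 1 = n + m) → (k : Fin n) →
    {X : Fin p → C} → {Y : Fin n → C} → {W : Fin m → C} →
    (aL : ∀ (i : Fin n) (q : Fin p), (i : ℕ) < k → (q : ℕ) = i → (X q ⟶ Y i)) →
    (c : ∀ (j : Fin m) (q : Fin p), (q : ℕ) = k + j → (X q ⟶ W j)) →
    (aR : ∀ (i : Fin n) (q : Fin p), (k : ℕ) < i → (q : ℕ) + 1 = i + m → (X q ⟶ Y i)) →
    (tens X ⟶ (slotFunctor k Y).obj (tens W))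
  | n + 1, m, p, h, ⟨0, _⟩, _, Y, _, _, c, aR =>
    splitMap (n := m) (m := n) (p := p) (by omega) (Z := fun i => Y i.succ)
      (fun j q hq => c j q (by simpa using hq))
      (fun i q hq => aR i.succ q (by simp) (by simp [hq]; omega))
  | n + 1, m, 0, h, ⟨k + 1, hk⟩, _, _, _, _, _, _ => absurd h (by omega)
  | n + 1, m, p + 1, h, ⟨k + 1, hk⟩, X, Y, W, aL, c, aR =>
    aL 0 0 (by simp) rfl ⊗ₘ
      groupMap (n := n) (m := m) (p := p) (by omega) ⟨k, by omega⟩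
        (X := fun q => X q.succ) (Y := fun i => Y i.succ) (W := W)
        (fun i q hi hq => aL i.succ q.succ (by simpa using hi) (by simpa using hq))
        (fun j q hq => c j q.succ (by simp at hq ⊢; omega))
        (fun i q hi hq => aR i.succ q.succ (by simpa using hi) (by simp; omega))

theorem blockMap_eq_groupMap_comp : ∀ {n m p : ℕ} (h : p + 1 = n + m) (k : Fin n)
    {X : Fin p → C} {Y : Fin n → C} {W : Fin m → C}
    (aL : ∀ (i : Fin n) (q : Fin p), (i : ℕ) < k → (q : ℕ) = i → (X q ⟶ Y i))
    (c : ∀ (j : Fin m) (q : Fin p), (q : ℕ) = k + j → (X q ⟶ W j))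
    (aR : ∀ (i : Fin n) (q : Fin p), (k : ℕ) < i → (q : ℕ) + 1 = i + m → (X q ⟶ Y i))
    (b : tens W ⟶ Y k),
    blockMap h k aL c aR b = groupMap h k aL c aR ≫ (slotFunctor k Y).map b ≫ (slotIso k Y).hom
  | n + 1, m, p, h, ⟨0, _⟩, _, Y, _, _, c, aR, b => by
    rw [blockMap, groupMap]
    exact congrArg _ (Category.comp_id _).symm
  | n + 1, m, 0, h, ⟨k + 1, hk⟩, _, _, _, _, _, _, _ => absurd h (by omega)
  | n + 1, m, p + 1, h, ⟨k + 1, hk⟩, X, Y, W, aL, c, aR, b => by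
    rw [blockMap, groupMap, blockMap_eq_groupMap_comp (n := n) (m := m) (p := p)]
    exact tensorHom_comp_comp _ _ _ _

theorem isIso_groupMap : ∀ {n m p : ℕ} (h : p + 1 = n + m) (k : Fin n)
    {X : Fin p → C} {Y : Fin n → C} {W : Fin m → C}
    (aL : ∀ (i : Fin n) (q : Fin p), (i : ℕ) < k → (q : ℕ) = i → (X q ⟶ Y i))
    (c : ∀ (j : Fin m) (q : Fin p), (q : ℕ) = k + j → (X q ⟶ W j))
    (aR : ∀ (i : Fin n) (q : Fin p), (k : ℕ) < i → (q : ℕ) + 1 = i + m → (X q ⟶ Y i)),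
    (∀ i q hi hq, IsIso (aL i q hi hq)) → (∀ j q hq, IsIso (c j q hq)) →
    (∀ i q hi hq, IsIso (aR i q hi hq)) → IsIso (groupMap h k aL c aR)
  | n + 1, m, p, h, ⟨0, _⟩, _, Y, _, _, c, aR, _, hc, hR => by
    rw [groupMap]
    exact isIso_splitMap _ _ _ (fun _ _ _ => hc _ _ _) (fun _ _ _ => hR _ _ _ _)
  | n + 1, m, 0, h, ⟨k + 1, hk⟩, _, _, _, _, _, _, _, _, _ => absurd h (by omega)
  | n + 1, m, p + 1, h, ⟨k + 1, hk⟩, X, Y, W, aL, c, aR, hL, hc, hR => by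
    rw [groupMap]
    exact @tensor_isIso _ _ _ _ _ _ _ _ (hL _ _ _ _) _ (isIso_groupMap (n := n) (m := m) (p := p)
      _ ⟨k, by omega⟩ _ _ _ (fun _ _ _ _ => hL _ _ _ _) (fun _ _ _ => hc _ _ _)
      (fun _ _ _ _ => hR _ _ _ _))

/-- Naturality of `groupMap` in the factors of the block, the other factors being fixed. -/
theorem groupMap_naturality : ∀ {n m p : ℕ} (h : p + 1 = n + m) (k : Fin n)
    {X X' : Fin p → C} {Y : Fin n → C} {W W' : Fin m → C}
    {aL : ∀ (i : Fin n) (q : Fin p), (i : ℕ) < k → (q : ℕ) = i → (X q ⟶ Y i)}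
    {c : ∀ (j : Fin m) (q : Fin p), (q : ℕ) = k + j → (X q ⟶ W j)}
    {aR : ∀ (i : Fin n) (q : Fin p), (k : ℕ) < i → (q : ℕ) + 1 = i + m → (X q ⟶ Y i)}
    {aL' : ∀ (i : Fin n) (q : Fin p), (i : ℕ) < k → (q : ℕ) = i → (X' q ⟶ Y i)}
    {c' : ∀ (j : Fin m) (q : Fin p), (q : ℕ) = k + j → (X' q ⟶ W' j)}
    {aR' : ∀ (i : Fin n) (q : Fin p), (k : ℕ) < i → (q : ℕ) + 1 = i + m → (X' q ⟶ Y i)}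
    (x : ∀ q, X q ⟶ X' q) (w : ∀ j, W j ⟶ W' j),
    (∀ i q hi hq, x q ≫ aL' i q hi hq = aL i q hi hq) →
    (∀ j q hq, x q ≫ c' j q hq = c j q hq ≫ w j) →
    (∀ i q hi hq, x q ≫ aR' i q hi hq = aR i q hi hq) →
    tensMap x ≫ groupMap h k aL' c' aR' = groupMap h k aL c aR ≫ (slotFunctor k Y).map (tensMap w)
  | n + 1, m, p, h, ⟨0, _⟩, _, _, Y, _, _, aL, c, aR, aL', c', aR', x, w, _, hc, hR => by
    rw [groupMap, groupMap]
    refine (splitMap_naturality _ x w (fun i => 𝟙 (Y i.succ)) (fun _ _ _ => hc _ _ _)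
      (fun _ _ _ => (hR _ _ _ _).trans (Category.comp_id _).symm)).trans ?_
    rw [tensMap_id, tensorHom_id]
    rfl
  | n + 1, m, 0, h, ⟨k + 1, hk⟩, _, _, _, _, _, _, _, _, _, _, _, _, _, _, _, _ =>
    absurd h (by omega)
  | n + 1, m, p + 1, h, ⟨k + 1, hk⟩, X, X', Y, W, W', aL, c, aR, aL', c', aR', x, w, hL, hc, hR => by
    have ih := groupMap_naturality (n := n) (m := m) (p := p) (by omega) ⟨k, by omega⟩
        (Y := fun i => Y i.succ)
        (aL := fun i q hi hq => aL i.succ q.succ (by simpa using hi) (by simpa using hq))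
        (c := fun j q hq => c j q.succ (by simp at hq ⊢; omega))
        (aR := fun i q hi hq => aR i.succ q.succ (by simpa using hi) (by simp; omega))
        (aL' := fun i q hi hq => aL' i.succ q.succ (by simpa using hi) (by simpa using hq))
        (c' := fun j q hq => c' j q.succ (by simp at hq ⊢; omega))
        (aR' := fun i q hi hq => aR' i.succ q.succ (by simpa using hi) (by simp; omega))
        (fun q => x q.succ) w (fun _ _ _ _ => hL _ _ _ _) (fun _ _ _ => hc _ _ _)
        (fun _ _ _ _ => hR _ _ _ _)
    rw [groupMap, groupMap]
    exact tensorHom_comp_whiskerLeft_square (hL _ _ _ _) ih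

theorem blockMap_naturality : ∀ {n m p : ℕ} (h : p + 1 = n + m) (k : Fin n)
    {X X' : Fin p → C} {Y Y' : Fin n → C} {W W' : Fin m → C}
    {aL : ∀ (i : Fin n) (q : Fin p), (i : ℕ) < k → (q : ℕ) = i → (X q ⟶ Y i)}
    {c : ∀ (j : Fin m) (q : Fin p), (q : ℕ) = k + j → (X q ⟶ W j)}
    {aR : ∀ (i : Fin n) (q : Fin p), (k : ℕ) < i → (q : ℕ) + 1 = i + m → (X q ⟶ Y i)}
    {b : tens W ⟶ Y k}
    {aL' : ∀ (i : Fin n) (q : Fin p), (i : ℕ) < k → (q : ℕ) = i → (X' q ⟶ Y' i)}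
    {c' : ∀ (j : Fin m) (q : Fin p), (q : ℕ) = k + j → (X' q ⟶ W' j)}
    {aR' : ∀ (i : Fin n) (q : Fin p), (k : ℕ) < i → (q : ℕ) + 1 = i + m → (X' q ⟶ Y' i)}
    {b' : tens W' ⟶ Y' k}
    (x : ∀ q, X q ⟶ X' q) (y : ∀ i, Y i ⟶ Y' i) (w : ∀ j, W j ⟶ W' j),
    (∀ i q hi hq, x q ≫ aL' i q hi hq = aL i q hi hq ≫ y i) →
    (∀ j q hq, x q ≫ c' j q hq = c j q hq ≫ w j) →
    (∀ i q hi hq, x q ≫ aR' i q hi hq = aR i q hi hq ≫ y i) →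
    tensMap w ≫ b' = b ≫ y k →
    tensMap x ≫ blockMap h k aL' c' aR' b' = blockMap h k aL c aR b ≫ tensMap y
  | n + 1, m, p, h, ⟨0, _⟩, _, _, Y, Y', _, _, aL, c, aR, b, aL', c', aR', b', x, y, w, _, hc, hR, hb => by
    rw [blockMap, blockMap]
    exact comp_whiskerRight_square (splitMap_naturality _ x w (fun i => y i.succ)
      (fun _ _ _ => hc _ _ _) (fun _ _ _ => hR _ _ _ _)) hb
  | n + 1, m, 0, h, ⟨k + 1, hk⟩, _, _, _, _, _, _, _, _, _, _, _, _, _, _, _, _, _, _, _, _, _ =>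
    absurd h (by omega)
  | n + 1, m, p + 1, h, ⟨k + 1, hk⟩, X, X', Y, Y', W, W', aL, c, aR, b, aL', c', aR', b', x, y, w,
      hL, hc, hR, hb => by
    have ih := blockMap_naturality (n := n) (m := m) (p := p) (by omega) ⟨k, by omega⟩
        (aL := fun i q hi hq => aL i.succ q.succ (by simpa using hi) (by simpa using hq))
        (c := fun j q hq => c j q.succ (by simp at hq ⊢; omega))
        (aR := fun i q hi hq => aR i.succ q.succ (by simpa using hi) (by simp; omega))
        (b := b)
        (aL' := fun i q hi hq => aL' i.succ q.succ (by simpa using hi) (by simpa using hq))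
        (c' := fun j q hq => c' j q.succ (by simp at hq ⊢; omega))
        (aR' := fun i q hi hq => aR' i.succ q.succ (by simpa using hi) (by simp; omega))
        (b' := b')
        (fun q => x q.succ) (fun i => y i.succ) w (fun _ _ _ _ => hL _ _ _ _) (fun _ _ _ => hc _ _ _)
        (fun _ _ _ _ => hR _ _ _ _) hb
    rw [blockMap, blockMap]
    exact tensorHom_comp_square (hL _ _ _ _) ih

variable [SymmetricCategory C]

/-- The braiding moves `A` past `Z` in `A ⊗ (Z ⊗ T)`, naturally. -/
theorem braidPast_square {A A' Z Z' T T' B B' D D' : C} {x : A ⟶ A'} {z : Z ⟶ Z'} {t : T ⟶ T'}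
    {b : Z ⟶ B} {b' : Z' ⟶ B'} {y : B ⟶ B'} {e : A ⊗ T ⟶ D} {e' : A' ⊗ T' ⟶ D'} {d : D ⟶ D'}
    (h : z ≫ b' = b ≫ y) (h' : (x ⊗ₘ t) ≫ e' = e ≫ d) :
    (x ⊗ₘ (z ⊗ₘ t)) ≫ (α_ A' Z' T').inv ≫ ((β_ A' Z').hom ▷ T') ≫ (α_ Z' A' T').hom ≫ (b' ⊗ₘ e') =
      ((α_ A Z T).inv ≫ ((β_ A Z).hom ▷ T) ≫ (α_ Z A T).hom ≫ (b ⊗ₘ e)) ≫ (y ⊗ₘ d) := by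
  simp only [Category.assoc]
  rw [associator_inv_naturality_assoc, tensorHom_comp_whiskerRight_assoc,
    BraidedCategory.braiding_naturality, ← whiskerRight_comp_tensorHom_assoc,
    associator_naturality_assoc, tensorHom_comp_square h h']

theorem isIso_braidPast {A Z T B D : C} (b : Z ⟶ B) (e : A ⊗ T ⟶ D) [IsIso (b ⊗ₘ e)] :
    IsIso ((α_ A Z T).inv ≫ ((β_ A Z).hom ▷ T) ≫ (α_ Z A T).hom ≫ (b ⊗ₘ e)) :=
  inferInstance

theorem isIso_moveMap : ∀ {n : ℕ} (k : Fin (n + 1)) {A : C} {Z : Fin n → C} {Y : Fin (n + 1) → C}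
    (a : A ⟶ Y k) (b : ∀ (i : Fin n) (j : Fin (n + 1)), j = k.succAbove i → (Z i ⟶ Y j)),
    IsIso a → (∀ i j hj, IsIso (b i j hj)) → IsIso (moveMap k a b)
  | n, ⟨0, _⟩, _, _, _, a, b, ha, hb => by
    rw [moveMap]
    have := isIso_tensMap (fun i => b i i.succ (by simp)) fun i => hb _ _ _
    exact @tensor_isIso _ _ _ _ _ _ _ a ha _ _
  | 0, ⟨k + 1, hk⟩, _, _, _, _, _, _, _ => absurd hk (by omega)
  | n + 1, ⟨k + 1, hk⟩, A, Z, Y, a, b, ha, hb => by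
    rw [moveMap]
    exact @isIso_braidPast _ _ _ _ _ _ _ _ _ _ _ (@tensor_isIso _ _ _ _ _ _ _ _ (hb _ _ _) _
      (isIso_moveMap (n := n) ⟨k, by omega⟩ _ _ ha (fun _ _ _ => hb _ _ _)))

theorem moveMap_naturality : ∀ {n : ℕ} (k : Fin (n + 1)) {A A' : C} {Z Z' : Fin n → C}
    {Y Y' : Fin (n + 1) → C} {a : A ⟶ Y k}
    {b : ∀ (i : Fin n) (j : Fin (n + 1)), j = k.succAbove i → (Z i ⟶ Y j)} {a' : A' ⟶ Y' k}
    {b' : ∀ (i : Fin n) (j : Fin (n + 1)), j = k.succAbove i → (Z' i ⟶ Y' j)}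
    (x : A ⟶ A') (z : ∀ i, Z i ⟶ Z' i) (y : ∀ j, Y j ⟶ Y' j), x ≫ a' = a ≫ y k →
    (∀ i j hj, z i ≫ b' i j hj = b i j hj ≫ y j) →
    (x ⊗ₘ tensMap z) ≫ moveMap k a' b' = moveMap k a b ≫ tensMap y
  | n, ⟨0, _⟩, _, _, _, _, _, _, a, b, a', b', x, z, y, ha, hb => by
    rw [moveMap, moveMap]
    refine tensorHom_comp_square ha ?_
    rw [← tensMap_comp, ← tensMap_comp]
    exact congrArg tensMap (funext fun i => hb _ _ _)
  | 0, ⟨k + 1, hk⟩, _, _, _, _, _, _, _, _, _, _, _, _, _, _, _ => absurd hk (by omega)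
  | n + 1, ⟨k + 1, hk⟩, A, A', Z, Z', Y, Y', a, b, a', b', x, z, y, ha, hb => by
    have ih := moveMap_naturality (n := n) ⟨k, by omega⟩ (A := A) (Z := fun i => Z i.succ)
      (Y := fun j => Y j.succ) (Y' := fun j => Y' j.succ) (a := a)
      (b := fun i j hj => b i.succ j.succ (by
            subst hj
            exact (Fin.succ_succAbove_succ ⟨k, by omega⟩ i).symm)) (a' := a')
      (b' := fun i j hj => b' i.succ j.succ (by
            subst hj
            exact (Fin.succ_succAbove_succ ⟨k, by omega⟩ i).symm)) x (fun i => z i.succ)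
      (fun j => y j.succ) ha (fun _ _ _ => hb _ _ _)
    rw [moveMap, moveMap]
    exact braidPast_square (hb _ _ _) ih

theorem isIso_permMap : ∀ {n : ℕ} (σ : Equiv.Perm (Fin n)) {X Y : Fin n → C}
    (a : ∀ i j : Fin n, j = σ i → (X i ⟶ Y j)), (∀ i j hj, IsIso (a i j hj)) →
    IsIso (permMap σ a)
  | 0, _, _, _, _, _ => by rw [permMap]; exact IsIso.id _
  | n + 1, σ, X, Y, a, ha => by
    rw [permMap]
    exact @IsIso.comp_isIso _ _ _ _ _ _ _ (@whiskerLeft_isIso _ _ _ _ _ _ _ (isIso_permMap _ _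
      (fun _ _ _ => ha _ _ _))) (isIso_moveMap _ _ _ (ha _ _ _) (fun _ _ _ => inferInstance))

theorem permMap_naturality : ∀ {n : ℕ} (σ : Equiv.Perm (Fin n)) {X X' Y Y' : Fin n → C}
    {a : ∀ i j : Fin n, j = σ i → (X i ⟶ Y j)} {a' : ∀ i j : Fin n, j = σ i → (X' i ⟶ Y' j)}
    (x : ∀ i, X i ⟶ X' i) (y : ∀ j, Y j ⟶ Y' j),
    (∀ i j hj, x i ≫ a' i j hj = a i j hj ≫ y j) →
    tensMap x ≫ permMap σ a' = permMap σ a ≫ tensMap y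
  | 0, _, _, _, _, _, _, _, _, _, _ => by
    rw [permMap, permMap]
    rfl
  | n + 1, σ, X, X', Y, Y', a, a', x, y, ha => by
    have ih := permMap_naturality (n := n) (permTail σ) (Y := fun i => Y ((σ 0).succAbove i))
      (Y' := fun i => Y' ((σ 0).succAbove i))
      (a := fun i j hj => a i.succ ((σ 0).succAbove j) (by rw [hj, succAbove_permTail]))
      (a' := fun i j hj => a' i.succ ((σ 0).succAbove j) (by rw [hj, succAbove_permTail]))
      (fun i => x i.succ) (fun j => y ((σ 0).succAbove j)) (fun _ _ _ => ha _ _ _)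
    rw [permMap, permMap]
    exact whiskerLeft_comp_square ih (moveMap_naturality (σ 0) (x 0)
      (fun i => y ((σ 0).succAbove i)) y (ha _ _ _) (fun i j hj => by subst hj; simp))

end Tensor

/-! ### The faces of a join composition -/

section Faces

variable {n m p : ℕ}

/-- Pairs `(I, J)` and faces form a Galois connection, `S ↦ (outerPart S, innerPart S)` being the lower
adjoint of `joinFace`. -/
theorem subset_joinFace_iff (h : p + 1 = n + m) (k : Fin n) (S : Finset (Fin p))
    (I : Finset (Fin n)) (J : Finset (Fin m)) : S ⊆ joinFace h k I J ↔
      SimplicialCpx.outerPart h k S ⊆ I ∧ SimplicialCpx.innerPart h k S ⊆ J := by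
  constructor
  · intro hS
    constructor
    · intro i hi
      obtain ⟨hik, hi⟩ := (SimplicialCpx.mem_outerPart h k S i).1 hi
      exact (outer_mem_joinFace h k I J i hik).1 (hS hi)
    · intro j hj
      exact (inner_mem_joinFace h k I J j).1 (hS ((SimplicialCpx.mem_innerPart h k S j).1 hj))
  · rintro ⟨hI, hJ⟩ q hq
    obtain ⟨⟨i, hi⟩ | j, rfl⟩ := (position_bijective h k).2 q
    · exact (outer_mem_joinFace h k I J i hi).2
        (hI ((SimplicialCpx.mem_outerPart h k S i).2 ⟨hi, hq⟩))
    · exact (inner_mem_joinFace h k I J j).2 (hJ ((SimplicialCpx.mem_innerPart h k S j).2 hq))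

theorem joinFace_mono (h : p + 1 = n + m) (k : Fin n) {I I' : Finset (Fin n)}
    {J J' : Finset (Fin m)} (hI : I ⊆ I') (hJ : J ⊆ J') :
    joinFace h k I J ⊆ joinFace h k I' J' := by
  have := (subset_joinFace_iff h k (joinFace h k I J) I J).1 subset_rfl
  exact (subset_joinFace_iff h k _ I' J').2 ⟨this.1.trans hI, this.2.trans hJ⟩

theorem RelComplex.side_mono (P : RelComplex n) {s t : Bool} (hst : s ≤ t) :
    P.side s ≤ P.side t := by
  cases s <;> cases t
  · exact le_rfl
  · exact P.le
  · exact absurd hst (by decide)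
  · exact le_rfl

/-- Every face of a join composition is of the form `joinFace h k I J`. It may be so for two sets `I`,
which then differ by `k` only. -/
theorem exists_joinFace_eq (h : p + 1 = n + m) (k : Fin n) (P : RelComplex n) (Q : RelComplex m)
    (s : Bool) {S : Finset (Fin p)} (hS : S ∈ (P.comp h k Q).side s) :
    ∃ I ∈ P.side s, ∃ J ∈ Q.side (decide (k ∈ I)), joinFace h k I J = S := by
  have key : ∀ K : SimplicialCpx n, S ∈ SimplicialCpx.joinAction h k K Q.K Q.L →
      ∃ I ∈ K, ∃ J ∈ Q.side (decide (k ∈ I)), joinFace h k I J = S := by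
    intro K hK
    have hk : k ∉ SimplicialCpx.outerPart h k S := by simp
    have hpart (I : Finset (Fin n)) (hI : I.erase k = SimplicialCpx.outerPart h k S) :
        joinFace h k I (SimplicialCpx.innerPart h k S) = S := by
      ext q
      obtain ⟨⟨i, hi⟩ | j, rfl⟩ := (position_bijective h k).2 q
      · have := Finset.ext_iff.1 hI i
        simp only [Finset.mem_erase, SimplicialCpx.mem_outerPart] at this
        simp only [Sum.elim_inl, outer_mem_joinFace]
        tauto
      · simp [inner_mem_joinFace]
    rcases (SimplicialCpx.mem_joinAction h k K Q.K Q.L S).1 hK with ⟨h1, h2⟩ | ⟨h1, h2⟩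
    · refine ⟨_, h1, _, ?_, hpart _ (Finset.erase_insert hk)⟩
      simpa [RelComplex.side] using h2
    · refine ⟨_, h1, _, ?_, hpart _ (Finset.erase_eq_of_notMem hk)⟩
      simpa [hk, RelComplex.side] using h2
  cases s with
  | true => exact key P.K hS
  | false => exact key P.L hS

/-- The pairs `(I, J)` indexing the faces of a join composition are closed under intersections. -/
theorem inter_mem_side (k : Fin n) (Q : RelComplex m) {I I' : Finset (Fin n)} {J J' : Finset (Fin m)}
    (hJ : J ∈ Q.side (decide (k ∈ I))) (hJ' : J' ∈ Q.side (decide (k ∈ I'))) :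
    J ∩ J' ∈ Q.side (decide (k ∈ I ∩ I')) := by
  by_cases hk : k ∈ I
  · by_cases hk' : k ∈ I'
    · simp only [hk, hk', Finset.mem_inter, and_self, decide_true] at hJ ⊢
      exact LowerSet.lower _ Finset.inter_subset_left hJ
    · simp only [hk', Finset.mem_inter, and_false, decide_false] at hJ' ⊢
      exact LowerSet.lower _ Finset.inter_subset_right hJ'
  · simp only [hk, Finset.mem_inter, false_and, decide_false] at hJ ⊢
    exact LowerSet.lower _ Finset.inter_subset_left hJ

end Faces

/-! ### Morphisms of arrows -/

section Arrows

variable {C : Type u} [Category.{v} C]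

theorem edge_eqToHom {F F' : Arrow C} (hF : F = F') {a a' b b' : Bool} (ha : a = a') (hb : b = b')
    (h : a ≤ b) (h' : a' ≤ b') :
    edge F h ≫ eqToHom (by rw [hF, hb]) = eqToHom (by rw [hF, ha]) ≫ edge F' h' := by
  subst hF ha hb
  simp

theorem edge_vertexMap {F G : Arrow C} (e : F ⟶ G) : ∀ {a b : Bool} (h : a ≤ b),
    edge F h ≫ vertexMap e b = vertexMap e a ≫ edge G h
  | true, true, _ => (Category.id_comp _).trans (Category.comp_id _).symm
  | false, true, _ => (Arrow.w e).symm
  | false, false, _ => (Category.id_comp _).trans (Category.comp_id _).symm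
  | true, false, h => absurd h (by decide)

theorem isIso_vertexMap {F G : Arrow C} (e : F ⟶ G) [IsIso e] : ∀ s, IsIso (vertexMap e s)
  | true => inferInstanceAs (IsIso e.right)
  | false => inferInstanceAs (IsIso e.left)

/-- A morphism of arrows from its two components. -/
def arrowHom {F G : Arrow C} (e : ∀ s, vertex F s ⟶ vertex G s)
    (w : edge F (Bool.false_le true) ≫ e true = e false ≫ edge G (Bool.false_le true)) : F ⟶ G :=
  Arrow.homMk (e false) (e true) w.symm

theorem vertexMap_arrowHom {F G : Arrow C} (e : ∀ s, vertex F s ⟶ vertex G s)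
    (w : edge F (Bool.false_le true) ≫ e true = e false ≫ edge G (Bool.false_le true)) :
    ∀ s, vertexMap (arrowHom e w) s = e s
  | true => rfl
  | false => rfl

theorem arrowHom_ext {F G : Arrow C} {e e' : F ⟶ G} (h : ∀ s, vertexMap e s = vertexMap e' s) :
    e = e' :=
  Arrow.hom_ext _ _ (h false) (h true)

theorem isIso_of_vertexMap {F G : Arrow C} (e : F ⟶ G) (h : ∀ s, IsIso (vertexMap e s)) :
    IsIso e := by
  have : IsIso e.left := h false
  have : IsIso e.right := h true
  exact Arrow.isIso_of_isIso_left_of_isIso_right e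

end Arrows

/-! ### The universal property of the structure maps -/

section Coprojections

variable {C : Type u} [Category.{v} C] [MonoidalCategory C] [HasFiniteColimits C] {n : ℕ}

theorem joinι_naturality (P : RelComplex n) (f : Fin n → Arrow C) (s : Bool) {I J : Finset (Fin n)}
    (hIJ : I ≤ J) (hI : I ∈ P.side s) (hJ : J ∈ P.side s) :
    (cubical f).map (homOfLE hIJ) ≫ joinι P f s J hJ = joinι P f s I hI := by
  cases s with
  | true => exact colimit.w (diagram P.K f) (homOfLE hIJ : (⟨I, hI⟩ : FaceCat P.K) ⟶ ⟨J, hJ⟩)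
  | false => exact colimit.w (diagram P.L f) (homOfLE hIJ : (⟨I, hI⟩ : FaceCat P.L) ⟶ ⟨J, hJ⟩)

/-- The edge of `joinMap P f` from an end to itself is an identity; from the source to the target, it
is the canonical morphism between the colimits. -/
theorem joinι_edge (P : RelComplex n) (f : Fin n → Arrow C) {s t : Bool} (hst : s ≤ t)
    {I : Finset (Fin n)} (hI : I ∈ P.side s) :
    joinι P f s I hI ≫ edge (joinMap P f) hst = joinι P f t I (P.side_mono hst hI) := by
  cases s <;> cases t
  · exact Category.comp_id _
  · exact colimit.ι_pre (diagram P.K f) (faceCatIncl P.le) (⟨I, hI⟩ : FaceCat P.L)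
  · exact absurd hst (by decide)
  · exact Category.comp_id _

/-- The ends of `joinMap P f`, as cocones over the cubical functor. -/
noncomputable def joinCocone (P : RelComplex n) (f : Fin n → Arrow C) (s : Bool) :
    Cocone (diagram (P.side s) f) where
  pt := vertex (joinMap P f) s
  ι :=
    { app := fun I => joinι P f s I.1 I.2
      naturality := fun I J u =>
        (joinι_naturality P f s (leOfHom u) I.2 J.2).trans (Category.comp_id _).symm }

/-- The ends of `joinMap P f` are colimits. -/
noncomputable def joinCoconeIsColimit (P : RelComplex n) (f : Fin n → Arrow C) :
    ∀ s : Bool, IsColimit (joinCocone P f s)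
  | true => IsColimit.ofIsoColimit (colimit.isColimit (diagram P.K f))
      (Cocone.ext (Iso.refl _) fun _ => Category.comp_id _)
  | false => IsColimit.ofIsoColimit (colimit.isColimit (diagram P.L f))
      (Cocone.ext (Iso.refl _) fun _ => Category.comp_id _)

theorem joinι_hom_ext {P : RelComplex n} {f : Fin n → Arrow C} {s : Bool} {T : C}
    {u u' : vertex (joinMap P f) s ⟶ T}
    (h : ∀ I hI, joinι P f s I hI ≫ u = joinι P f s I hI ≫ u') : u = u' :=
  (joinCoconeIsColimit P f s).hom_ext fun I => h I.1 I.2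

theorem exists_joinι_desc (P : RelComplex n) (f : Fin n → Arrow C) (s : Bool) {T : C}
    (φ : ∀ I, I ∈ P.side s → ((cubical f).obj I ⟶ T))
    (hφ : ∀ I J (hIJ : I ≤ J) (hI : I ∈ P.side s) (hJ : J ∈ P.side s),
      (cubical f).map (homOfLE hIJ) ≫ φ J hJ = φ I hI) :
    ∃ u : vertex (joinMap P f) s ⟶ T, ∀ I hI, joinι P f s I hI ≫ u = φ I hI :=
  ⟨(joinCoconeIsColimit P f s).desc
      { pt := T
        ι :=
          { app := fun I => φ I.1 I.2
            naturality := fun I J u =>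
              (hφ I.1 J.1 (leOfHom u) I.2 J.2).trans (Category.comp_id _).symm } },
    fun I hI => (joinCoconeIsColimit P f s).fac _ (⟨I, hI⟩ : FaceCat (P.side s))⟩

/-- A family of compatible maps `θ` from the values of the cubical functor to the ends of an arrow `G`
is induced by a unique isomorphism `joinMap P f ≅ G` as soon as the maps `θ` are jointly epic and the
coprojections factor through them. -/
theorem existsUnique_joinIso (P : RelComplex n) (f : Fin n → Arrow C) (G : Arrow C)
    (θ : ∀ s I, I ∈ P.side s → ((cubical f).obj I ⟶ vertex G s))
    (hθ : ∀ s I J (hIJ : I ≤ J) (hI : I ∈ P.side s) (hJ : J ∈ P.side s),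
      (cubical f).map (homOfLE hIJ) ≫ θ s J hJ = θ s I hI)
    (hedge : ∀ I (hI : I ∈ P.side false), θ false I hI ≫ edge G (Bool.false_le true) =
      θ true I (P.side_mono (Bool.false_le true) hI))
    (hdesc : ∀ s, ∃ u : vertex G s ⟶ vertex (joinMap P f) s,
      ∀ I hI, θ s I hI ≫ u = joinι P f s I hI)
    (hext : ∀ s (u u' : vertex G s ⟶ vertex G s),
      (∀ I hI, θ s I hI ≫ u = θ s I hI ≫ u') → u = u') :
    ∃! e : joinMap P f ≅ G, ∀ s I hI, joinι P f s I hI ≫ vertexMap e.hom s = θ s I hI := by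
  choose a ha using fun s => exists_joinι_desc P f s (θ s) (hθ s)
  choose b hb using hdesc
  have hw : edge (joinMap P f) (Bool.false_le true) ≫ a true =
      a false ≫ edge G (Bool.false_le true) := by
    apply joinι_hom_ext
    intro I hI
    rw [← Category.assoc, joinι_edge, ha, ← Category.assoc, ha, hedge]
  have hiso : IsIso (arrowHom a hw) := by
    refine isIso_of_vertexMap _ fun s => ?_
    rw [vertexMap_arrowHom]
    refine ⟨b s, ?_, ?_⟩
    · apply joinι_hom_ext
      intro I hI
      rw [← Category.assoc, ha, hb, Category.comp_id]
    · apply hext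
      intro I hI
      rw [← Category.assoc, hb, ha, Category.comp_id]
  refine ⟨asIso (arrowHom a hw), fun s I hI => ?_, fun e he => ?_⟩
  · rw [asIso_hom, vertexMap_arrowHom, ha]
  · ext1
    refine arrowHom_ext fun s => joinι_hom_ext fun I hI => ?_
    rw [he, asIso_hom, vertexMap_arrowHom, ha]

/-- Naturally isomorphic diagrams, over isomorphic face posets, give isomorphic arrows. -/
theorem existsUnique_joinIso_of_orderIso (P P' : RelComplex n) (f f' : Fin n → Arrow C)
    (ρ : Finset (Fin n) ≃o Finset (Fin n)) (hρ : ∀ s I, I ∈ P.side s ↔ ρ I ∈ P'.side s)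
    (t : ∀ I, (cubical f).obj I ⟶ (cubical f').obj (ρ I)) (ht : ∀ I, IsIso (t I))
    (hnat : ∀ I J (hIJ : I ≤ J),
      (cubical f).map (homOfLE hIJ) ≫ t J = t I ≫ (cubical f').map (homOfLE (ρ.monotone hIJ))) :
    ∃! e : joinMap P f ≅ joinMap P' f', ∀ s I (hI : I ∈ P.side s),
      joinι P f s I hI ≫ vertexMap e.hom s = t I ≫ joinι P' f' s (ρ I) ((hρ s I).1 hI) := by
  refine existsUnique_joinIso P f (joinMap P' f')
    (fun s I hI => t I ≫ joinι P' f' s (ρ I) ((hρ s I).1 hI)) ?_ ?_ ?_ ?_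
  · intro s I J hIJ hI hJ
    rw [← Category.assoc, hnat, Category.assoc, joinι_naturality]
  · intro I hI
    rw [Category.assoc, joinι_edge]
  · intro s
    have hmem (I) (hI : I ∈ P'.side s) : ρ.symm I ∈ P.side s := by
      rwa [hρ, OrderIso.apply_symm_apply]
    -- `I` and `ρ (ρ.symm I)` are equal, but the arrow given by an inequality avoids a transport
    have hle (I) : I ≤ ρ (ρ.symm I) := (ρ.apply_symm_apply I).ge
    obtain ⟨u, hu⟩ := exists_joinι_desc P' f' s
      (fun I hI => (cubical f').map (homOfLE (hle I)) ≫ inv (t (ρ.symm I)) ≫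
        joinι P f s (ρ.symm I) (hmem I hI)) (by
        intro I J hIJ hI hJ
        rw [← joinι_naturality P f s (ρ.symm.monotone hIJ) (hmem I hI) (hmem J hJ)]
        have := hnat _ _ (ρ.symm.monotone hIJ)
        rw [← IsIso.inv_comp_eq, ← Category.assoc, ← IsIso.eq_comp_inv] at this
        rw [reassoc_of% this, ← Functor.map_comp_assoc, ← Functor.map_comp_assoc]
        congr 1)
    refine ⟨u, fun I hI => ?_⟩
    rw [Category.assoc, hu]
    have h1 : I ≤ ρ.symm (ρ I) := (ρ.symm_apply_apply I).ge
    have h2 := hnat _ _ h1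
    rw [← joinι_naturality P f s h1 hI (hmem _ ((hρ s I).1 hI)), ← reassoc_of% h2,
      IsIso.hom_inv_id_assoc]
  · intro s u u' h
    apply joinι_hom_ext
    intro I hI
    obtain ⟨I, rfl⟩ := ρ.surjective I
    have := h I ((hρ s I).2 hI)
    rwa [Category.assoc, Category.assoc, cancel_epi] at this

/-- The structure maps are well defined on isomorphism classes of arrows. -/
theorem nonempty_joinMap_iso (P : RelComplex n) {f g : Fin n → Arrow C}
    (e : ∀ i, Nonempty (f i ≅ g i)) : Nonempty (joinMap P f ≅ joinMap P g) := by
  refine (existsUnique_joinIso_of_orderIso P P f g (OrderIso.refl _) (fun _ _ => Iff.rfl)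
    (fun I => tensMap fun i => vertexMap (e i).some.hom (decide (i ∈ I)))
    (fun I => isIso_tensMap _ fun i => isIso_vertexMap _ _) fun I J hIJ => ?_).exists.nonempty
  refine (tensMap_comp _ _).symm.trans (Eq.trans ?_ (tensMap_comp _ _))
  exact congrArg tensMap (funext fun i => edge_vertexMap _ _)

end Coprojections

/-! ### The unit and the symmetric group actions -/

section UnitAndAction

variable {C : Type u} [Category.{v} C] [MonoidalCategory C]

theorem unitFaceMap_naturality (f : Fin 1 → Arrow C) (s : Bool) {I J : Finset (Fin 1)}
    (hIJ : I ≤ J) (hI : I ∈ RelComplex.unit.side s) (hJ : J ∈ RelComplex.unit.side s) :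
    (cubical f).map (homOfLE hIJ) ≫ unitFaceMap f s J hJ = unitFaceMap f s I hI := by
  have h : ∀ {A B D : C} (x : A ⟶ B) (y : B ⟶ D) (z : A ⟶ D), x ≫ y = z →
      (x ⊗ₘ 𝟙 (𝟙_ C)) ≫ (ρ_ B).hom ≫ y = (ρ_ A).hom ≫ z := by
    rintro A B D x y z rfl
    simp
  exact h _ _ _ (edge_comp _ _ _).symm

theorem existsUnique_unit_iso [HasFiniteColimits C] (f : Fin 1 → Arrow C) :
    ∃! e : joinMap RelComplex.unit f ≅ f 0,
      ∀ (s : Bool) (I : Finset (Fin 1)) (hI : I ∈ RelComplex.unit.side s),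
        joinι RelComplex.unit f s I hI ≫ vertexMap e.hom s = unitFaceMap f s I hI := by
  -- the greatest face of each side, at which `unitFaceMap` is the unit isomorphism
  have htop : ∀ s, ∃ (I : Finset (Fin 1)) (hI : I ∈ RelComplex.unit.side s),
      (∀ J ∈ RelComplex.unit.side s, J ≤ I) ∧ IsIso (unitFaceMap f s I hI) := by
    have h : ∀ s I (hI : I ∈ RelComplex.unit.side s), decide ((0 : Fin 1) ∈ I) = s →
        IsIso (unitFaceMap f s I hI) := by
      rintro _ I hI rfl
      rw [unitFaceMap, edge_refl]
      exact @IsIso.comp_isIso _ _ _ _ _ _ _ (Iso.isIso_hom (ρ_ _)) (IsIso.id _)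
    rintro (_ | _)
    · refine ⟨∅, (SimplicialCpx.mem_trivial ∅).2 rfl, fun J hJ => ?_, h _ _ _ (by simp)⟩
      exact ((SimplicialCpx.mem_trivial J).1 hJ).le
    · exact ⟨Finset.univ, SimplicialCpx.mem_simplex _, fun J _ => Finset.subset_univ J,
        h _ _ _ (by simp)⟩
  choose I hI hle hiso using htop
  refine existsUnique_joinIso _ _ _ _ (fun s _ _ h hI hJ => unitFaceMap_naturality f s h hI hJ)
    (fun I hI => ?_) (fun s => ?_) (fun s u u' h => ?_)
  · exact (Category.assoc _ _ _).trans (congrArg ((ρ_ _).hom ≫ ·) (edge_comp _ _ _).symm)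
  · refine ⟨inv (unitFaceMap f s (I s) (hI s)) ≫ joinι _ f s (I s) (hI s), fun J hJ => ?_⟩
    rw [← unitFaceMap_naturality f s (hle s J hJ) hJ (hI s), Category.assoc,
      IsIso.hom_inv_id_assoc, joinι_naturality]
  · have := h (I s) (hI s)
    rwa [cancel_epi] at this

theorem existsUnique_act_iso [HasFiniteColimits C] [SymmetricCategory C] {n : ℕ} (P : RelComplex n)
    (σ : Equiv.Perm (Fin n)) (f : Fin n → Arrow C) :
    ∃! e : joinMap (P.act σ) f ≅ joinMap P (f ∘ σ.symm),
      ∀ (s : Bool) (I : Finset (Fin n)) (hI : I ∈ (P.act σ).side s),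
        joinι (P.act σ) f s I hI ≫ vertexMap e.hom s =
          permFaceMap σ f I ≫ joinι P (f ∘ σ.symm) s (I.map σ.toEmbedding)
            (P.mem_side_act σ s hI) := by
  refine existsUnique_joinIso_of_orderIso (P.act σ) P f (f ∘ σ.symm)
    ⟨σ.finsetCongr, Finset.map_subset_map⟩ (fun s I => ?_) (permFaceMap σ f)
    (fun I => isIso_permMap _ _ fun _ _ _ => inferInstance) fun I J hIJ => ?_
  · cases s <;> exact Iff.rfl
  · refine permMap_naturality σ _ _ fun i j hj => ?_
    subst hj
    exact edge_eqToHom (by simp) (by simp) (by simp) _ _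

end UnitAndAction

/-! ### The partial compositions -/

section Composition

variable {C : Type u} [Category.{v} C] [MonoidalCategory C] {n m p : ℕ}

theorem compFaceMap_naturality (h : p + 1 = n + m) (k : Fin n) (f : Fin p → Arrow C) (g : Arrow C)
    {I I' : Finset (Fin n)} {J J' : Finset (Fin m)} (hI : I ≤ I') (hJ : J ≤ J')
    (b : (cubical fun j => f (innerPos h k j)).obj J ⟶ vertex g (decide (k ∈ I)))
    (b' : (cubical fun j => f (innerPos h k j)).obj J' ⟶ vertex g (decide (k ∈ I')))
    (hb : (cubical fun j => f (innerPos h k j)).map (homOfLE hJ) ≫ b' =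
      b ≫ edge g (decide_mem_mono hI k)) :
    (cubical f).map (homOfLE (joinFace_mono h k hI hJ)) ≫ compFaceMap h k f g I' J' b' =
      compFaceMap h k f g I J b ≫ (cubical (insertAt h k f g)).map (homOfLE hI) := by
  refine blockMap_naturality h k _ _ (fun j => edge (f (innerPos h k j)) (decide_mem_mono hJ j))
    ?_ ?_ ?_ ?_
  · intro i q hi hq
    have hik : i ≠ k := fun he => by simp [he] at hi
    obtain rfl : outerPos h k i hik = q := by rw [outer_eq_iff]; omega
    exact edge_eqToHom (by simp only [insertAt_of_ne h hik]) (by simp only [outer_mem_joinFace])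
      (by simp only [outer_mem_joinFace]) _ _
  · intro j q hq
    obtain rfl : innerPos h k j = q := by rw [inner_eq_iff]; omega
    exact edge_eqToHom rfl (by simp only [inner_mem_joinFace]) (by simp only [inner_mem_joinFace]) _ _
  · intro i q hi hq
    have hik : i ≠ k := fun he => by simp [he] at hi
    obtain rfl : outerPos h k i hik = q := by rw [outer_eq_iff]; omega
    exact edge_eqToHom (by simp only [insertAt_of_ne h hik]) (by simp only [outer_mem_joinFace])
      (by simp only [outer_mem_joinFace]) _ _
  · have he := edge_eqToHom (insertAt_self h k f g).symm rfl rfl (decide_mem_mono hI k)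
      (decide_mem_mono hI k)
    have hb' := congrArg (· ≫ eqToHom (by rw [insertAt_self] : vertex g (decide (k ∈ I')) =
      vertex (insertAt h k f g k) (decide (k ∈ I')))) hb
    simp only [Category.assoc, he] at hb'
    exact hb'.trans (Category.assoc _ _ _).symm

/-- The isomorphism `zₚ(joinFace I J; f) ⟶ Y₁ ⊗ (⋯ ⊗ (zₘ(J; fₖ, …) ⊗ ⋯))`, where the `Yᵢ`, `i ≠ k`, are the
factors of `zₙ(I; f₁, …, fₖ₋₁, g, fₖ₊ₘ, …)`. -/
def groupFaceMap (h : p + 1 = n + m) (k : Fin n) (f : Fin p → Arrow C) (g : Arrow C)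
    (I : Finset (Fin n)) (J : Finset (Fin m)) :
    (cubical f).obj (joinFace h k I J) ⟶
      (slotFunctor k fun i => vertex (insertAt h k f g i) (decide (i ∈ I))).obj
        ((cubical fun j => f (innerPos h k j)).obj J) :=
  groupMap h k
    (fun i q hi hq => eqToHom (by
      have hik : i ≠ k := fun he => by simp [he] at hi
      obtain rfl : outerPos h k i hik = q := by rw [outer_eq_iff]; omega
      simp only [insertAt_of_ne h hik, outer_mem_joinFace]))
    (fun j q hq => eqToHom (by
      obtain rfl : innerPos h k j = q := by rw [inner_eq_iff]; omega
      simp only [inner_mem_joinFace]))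
    (fun i q hi hq => eqToHom (by
      have hik : i ≠ k := fun he => by simp [he] at hi
      obtain rfl : outerPos h k i hik = q := by rw [outer_eq_iff]; omega
      simp only [insertAt_of_ne h hik, outer_mem_joinFace]))

instance isIso_groupFaceMap (h : p + 1 = n + m) (k : Fin n) (f : Fin p → Arrow C) (g : Arrow C)
    (I : Finset (Fin n)) (J : Finset (Fin m)) : IsIso (groupFaceMap h k f g I J) :=
  isIso_groupMap _ _ _ _ _ (fun _ _ _ _ => inferInstance) (fun _ _ _ => inferInstance)
    (fun _ _ _ _ => inferInstance)

theorem groupFaceMap_naturality (h : p + 1 = n + m) (k : Fin n) (f : Fin p → Arrow C) (g : Arrow C)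
    (I : Finset (Fin n)) {J J' : Finset (Fin m)} (hJ : J ≤ J') :
    (cubical f).map (homOfLE (joinFace_mono h k le_rfl hJ)) ≫ groupFaceMap h k f g I J' =
      groupFaceMap h k f g I J ≫
        (slotFunctor k fun i => vertex (insertAt h k f g i) (decide (i ∈ I))).map
          ((cubical fun j => f (innerPos h k j)).map (homOfLE hJ)) := by
  -- outside the block the face does not change with `J`, so the edges there are identities
  have key : ∀ {F G : Arrow C} {a b c : Bool} (_ : F = G) (hb : b = c) (ha : a = c) (hab : a ≤ b),
      edge F hab ≫ eqToHom (by subst_vars; rfl : vertex F b = vertex G c) =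
        eqToHom (by subst_vars; rfl) := by
    intro F G a b c hFG hb ha hab
    subst hFG hb ha
    simp [edge_refl]
  refine groupMap_naturality h k _ (fun j => edge (f (innerPos h k j)) (decide_mem_mono hJ j))
    ?_ ?_ ?_
  · intro i q hi hq
    have hik : i ≠ k := fun he => by simp [he] at hi
    obtain rfl : outerPos h k i hik = q := by rw [outer_eq_iff]; omega
    exact key (insertAt_of_ne h hik f g).symm (by simp only [outer_mem_joinFace])
      (by simp only [outer_mem_joinFace]) _
  · intro j q hq
    obtain rfl : innerPos h k j = q := by rw [inner_eq_iff]; omega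
    exact edge_eqToHom rfl (by simp only [inner_mem_joinFace]) (by simp only [inner_mem_joinFace]) _ _
  · intro i q hi hq
    have hik : i ≠ k := fun he => by simp [he] at hi
    obtain rfl : outerPos h k i hik = q := by rw [outer_eq_iff]; omega
    exact key (insertAt_of_ne h hik f g).symm (by simp only [outer_mem_joinFace])
      (by simp only [outer_mem_joinFace]) _

/-- `compFaceMap` is `groupFaceMap` followed by the value of a functor at the map from the block, up to an
isomorphism which does not depend on `J` nor on this map. -/
theorem compFaceMap_eq_groupFaceMap_comp (h : p + 1 = n + m) (k : Fin n) (f : Fin p → Arrow C)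
    (g : Arrow C) (I : Finset (Fin n)) : ∃ r : (slotFunctor k fun i => vertex (insertAt h k f g i)
        (decide (i ∈ I))).obj (vertex g (decide (k ∈ I))) ≅ (cubical (insertAt h k f g)).obj I,
      ∀ (J : Finset (Fin m)) (b : (cubical fun j => f (innerPos h k j)).obj J ⟶
        vertex g (decide (k ∈ I))), compFaceMap h k f g I J b = groupFaceMap h k f g I J ≫
          (slotFunctor k fun i => vertex (insertAt h k f g i) (decide (i ∈ I))).map b ≫ r.hom := by
  refine ⟨(slotFunctor k _).mapIso (eqToIso (by rw [insertAt_self])) ≪≫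
    slotIso k fun i => vertex (insertAt h k f g i) (decide (i ∈ I)), fun J b => ?_⟩
  refine (blockMap_eq_groupMap_comp _ _ _ _ _ _).trans (congrArg (groupFaceMap h k f g I J ≫ ·) ?_)
  exact (congrArg (· ≫ _) ((slotFunctor k _).map_comp b _)).trans (Category.assoc _ _ _)

variable [HasFiniteColimits C]

theorem map_joinι_hom_ext (F : C ⥤ C) [PreservesFiniteColimits F] {P : RelComplex n}
    {f : Fin n → Arrow C} {s : Bool} {T : C} {u u' : F.obj (vertex (joinMap P f) s) ⟶ T}
    (h : ∀ I hI, F.map (joinι P f s I hI) ≫ u = F.map (joinι P f s I hI) ≫ u') : u = u' :=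
  (isColimitOfPreserves F (joinCoconeIsColimit P f s)).hom_ext fun I => h I.1 I.2

theorem exists_map_joinι_desc (F : C ⥤ C) [PreservesFiniteColimits F] (P : RelComplex n)
    (f : Fin n → Arrow C) (s : Bool) {T : C}
    (φ : ∀ I, I ∈ P.side s → (F.obj ((cubical f).obj I) ⟶ T))
    (hφ : ∀ I J (hIJ : I ≤ J) (hI : I ∈ P.side s) (hJ : J ∈ P.side s),
      F.map ((cubical f).map (homOfLE hIJ)) ≫ φ J hJ = φ I hI) :
    ∃ u : F.obj (vertex (joinMap P f) s) ⟶ T, ∀ I hI, F.map (joinι P f s I hI) ≫ u = φ I hI :=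
  ⟨(isColimitOfPreserves F (joinCoconeIsColimit P f s)).desc
      { pt := T
        ι :=
          { app := fun I => φ I.1 I.2
            naturality := fun I J u =>
              (hφ I.1 J.1 (leOfHom u) I.2 J.2).trans (Category.comp_id _).symm } },
    fun I hI => (isColimitOfPreserves F (joinCoconeIsColimit P f s)).fac _
      (⟨I, hI⟩ : FaceCat (P.side s))⟩

/-- The coprojection of the pair `(I, J)` into the end `s` of
`joinMap P (f₁, …, fₖ₋₁, joinMap Q (fₖ, …), fₖ₊ₘ, …)`. -/
noncomputable def compι (h : p + 1 = n + m) (k : Fin n) (P : RelComplex n) (Q : RelComplex m)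
    (f : Fin p → Arrow C) (s : Bool) (I : Finset (Fin n)) (hI : I ∈ P.side s) (J : Finset (Fin m))
    (hJ : J ∈ Q.side (decide (k ∈ I))) : (cubical f).obj (joinFace h k I J) ⟶
      vertex (joinMap P (insertAt h k f (joinMap Q fun j => f (innerPos h k j)))) s :=
  compFaceMap h k f (joinMap Q fun j => f (innerPos h k j)) I J
      (joinι Q (fun j => f (innerPos h k j)) (decide (k ∈ I)) J hJ) ≫
    joinι P (insertAt h k f (joinMap Q fun j => f (innerPos h k j))) s I hI

theorem compι_naturality (h : p + 1 = n + m) (k : Fin n) (P : RelComplex n) (Q : RelComplex m)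
    (f : Fin p → Arrow C) (s : Bool) {I I' : Finset (Fin n)} {J J' : Finset (Fin m)} (hII' : I ≤ I')
    (hJJ' : J ≤ J') (hI : I ∈ P.side s) (hI' : I' ∈ P.side s) (hJ : J ∈ Q.side (decide (k ∈ I)))
    (hJ' : J' ∈ Q.side (decide (k ∈ I'))) :
    (cubical f).map (homOfLE (joinFace_mono h k hII' hJJ')) ≫ compι h k P Q f s I' hI' J' hJ' =
      compι h k P Q f s I hI J hJ := by
  rw [compι, ← Category.assoc, compFaceMap_naturality h k f _ hII' hJJ'
    (joinι Q (fun j => f (innerPos h k j)) (decide (k ∈ I)) J hJ), Category.assoc,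
    joinι_naturality, compι]
  rw [joinι_edge, joinι_naturality]

/-- The map that a pair `(I, J)` induces on a face contained in the face indexed by `(I, J)` does not
depend on this pair: two pairs are compared with their intersection. -/
theorem map_comp_compι_eq (h : p + 1 = n + m) (k : Fin n) (P : RelComplex n) (Q : RelComplex m)
    (f : Fin p → Arrow C) (s : Bool) {S : Finset (Fin p)} {I I' : Finset (Fin n)}
    {J J' : Finset (Fin m)} (hI : I ∈ P.side s) (hI' : I' ∈ P.side s)
    (hJ : J ∈ Q.side (decide (k ∈ I))) (hJ' : J' ∈ Q.side (decide (k ∈ I')))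
    (hS : S ≤ joinFace h k I J) (hS' : S ≤ joinFace h k I' J') :
    (cubical f).map (homOfLE hS) ≫ compι h k P Q f s I hI J hJ =
      (cubical f).map (homOfLE hS') ≫ compι h k P Q f s I' hI' J' hJ' := by
  have h1 := (subset_joinFace_iff h k S I J).1 hS
  have h2 := (subset_joinFace_iff h k S I' J').1 hS'
  have hS'' : S ≤ joinFace h k (I ∩ I') (J ∩ J') := (subset_joinFace_iff h k S _ _).2
    ⟨Finset.subset_inter h1.1 h2.1, Finset.subset_inter h1.2 h2.2⟩
  have hII' : I ∩ I' ∈ P.side s := LowerSet.lower _ Finset.inter_subset_left hI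
  trans (cubical f).map (homOfLE hS'') ≫
    compι h k P Q f s (I ∩ I') hII' (J ∩ J') (inter_mem_side k Q hJ hJ')
  · rw [← compι_naturality h k P Q f s Finset.inter_subset_left Finset.inter_subset_left hII' hI
      (inter_mem_side k Q hJ hJ') hJ, ← Functor.map_comp_assoc]
    rfl
  · rw [← compι_naturality h k P Q f s Finset.inter_subset_right Finset.inter_subset_right hII' hI'
      (inter_mem_side k Q hJ hJ') hJ', ← Functor.map_comp_assoc]
    rfl

variable [∀ X : C, PreservesFiniteColimits (tensorLeft X)]
  [∀ X : C, PreservesFiniteColimits (tensorRight X)]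

/-- The values of the cubical functor of `f₁, …, fₖ₋₁, joinMap Q (fₖ, …), fₖ₊ₘ, …` are colimits of the
`zₚ(joinFace I J; f)` over `J`: uniqueness of the maps out of them. -/
theorem compFaceMap_hom_ext (h : p + 1 = n + m) (k : Fin n) (Q : RelComplex m)
    (f : Fin p → Arrow C) (I : Finset (Fin n)) {T : C}
    {u u' : (cubical (insertAt h k f (joinMap Q fun j => f (innerPos h k j)))).obj I ⟶ T}
    (hu : ∀ J hJ, compFaceMap h k f (joinMap Q fun j => f (innerPos h k j)) I J
        (joinι Q (fun j => f (innerPos h k j)) (decide (k ∈ I)) J hJ) ≫ u =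
      compFaceMap h k f (joinMap Q fun j => f (innerPos h k j)) I J
        (joinι Q (fun j => f (innerPos h k j)) (decide (k ∈ I)) J hJ) ≫ u') : u = u' := by
  obtain ⟨r, hr⟩ := compFaceMap_eq_groupFaceMap_comp (m := m) h k f
    (joinMap Q fun j => f (innerPos h k j)) I
  have := preservesFiniteColimits_slotFunctor k fun i =>
    vertex (insertAt h k f (joinMap Q fun j => f (innerPos h k j)) i) (decide (i ∈ I))
  rw [← cancel_epi r.hom]
  refine map_joinι_hom_ext (slotFunctor k _) fun J hJ => ?_
  have := hu J hJ
  simpa only [hr, Category.assoc, cancel_epi] using this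

/-- The values of the cubical functor of `f₁, …, fₖ₋₁, joinMap Q (fₖ, …), fₖ₊ₘ, …` are colimits of the
`zₚ(joinFace I J; f)` over `J`: existence of the maps out of them. -/
theorem exists_compFaceMap_desc (h : p + 1 = n + m) (k : Fin n) (Q : RelComplex m)
    (f : Fin p → Arrow C) (I : Finset (Fin n)) {T : C}
    (φ : ∀ J, J ∈ Q.side (decide (k ∈ I)) → ((cubical f).obj (joinFace h k I J) ⟶ T))
    (hφ : ∀ J J' (hJJ' : J ≤ J') (hJ : J ∈ Q.side (decide (k ∈ I)))
      (hJ' : J' ∈ Q.side (decide (k ∈ I))),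
      (cubical f).map (homOfLE (joinFace_mono h k le_rfl hJJ')) ≫ φ J' hJ' = φ J hJ) :
    ∃ u : (cubical (insertAt h k f (joinMap Q fun j => f (innerPos h k j)))).obj I ⟶ T,
      ∀ J hJ, compFaceMap h k f (joinMap Q fun j => f (innerPos h k j)) I J
        (joinι Q (fun j => f (innerPos h k j)) (decide (k ∈ I)) J hJ) ≫ u = φ J hJ := by
  obtain ⟨r, hr⟩ := compFaceMap_eq_groupFaceMap_comp (m := m) h k f
    (joinMap Q fun j => f (innerPos h k j)) I
  have := preservesFiniteColimits_slotFunctor k fun i =>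
    vertex (insertAt h k f (joinMap Q fun j => f (innerPos h k j)) i) (decide (i ∈ I))
  obtain ⟨u, hu⟩ := exists_map_joinι_desc (slotFunctor k _) Q (fun j => f (innerPos h k j))
    (decide (k ∈ I))
    (fun J hJ => inv (groupFaceMap h k f (joinMap Q fun j => f (innerPos h k j)) I J) ≫ φ J hJ)
    fun J J' hJJ' hJ hJ' => by
      rw [← hφ J J' hJJ' hJ hJ', IsIso.eq_inv_comp, ← reassoc_of% groupFaceMap_naturality h k f
        (joinMap Q fun j => f (innerPos h k j)) I hJJ', IsIso.hom_inv_id_assoc]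
  refine ⟨r.inv ≫ u, fun J hJ => ?_⟩
  rw [hr, Category.assoc, Category.assoc, Iso.hom_inv_id_assoc, hu, IsIso.hom_inv_id_assoc]

theorem existsUnique_comp_iso (h : p + 1 = n + m) (k : Fin n) (P : RelComplex n) (Q : RelComplex m)
    (f : Fin p → Arrow C) :
    ∃! e : joinMap (P.comp h k Q) f ≅
        joinMap P (insertAt h k f (joinMap Q fun j => f (innerPos h k j))),
      ∀ (s : Bool) (I : Finset (Fin n)) (hI : I ∈ P.side s) (J : Finset (Fin m))
        (hJ : J ∈ Q.side (decide (k ∈ I))),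
        joinι (P.comp h k Q) f s (joinFace h k I J) (joinFace_mem h k P Q s hI hJ) ≫
            vertexMap e.hom s = compι h k P Q f s I hI J hJ := by
  choose I hI J hJ hS using fun s S hS => exists_joinFace_eq h k P Q s (S := S) hS
  -- the map induced on the summand `S` by a chosen pair `(I, J)` with `joinFace h k I J = S`
  let θ : ∀ s S, S ∈ (P.comp h k Q).side s → ((cubical f).obj S ⟶
      vertex (joinMap P (insertAt h k f (joinMap Q fun j => f (innerPos h k j)))) s) :=
    fun s S hSs => (cubical f).map (homOfLE (hS s S hSs).ge) ≫
      compι h k P Q f s (I s S hSs) (hI s S hSs) (J s S hSs) (hJ s S hSs)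
  have hθ : ∀ s S hSs I' (hI' : I' ∈ P.side s) J' (hJ' : J' ∈ Q.side (decide (k ∈ I')))
      (hle : S ≤ joinFace h k I' J'),
      θ s S hSs = (cubical f).map (homOfLE hle) ≫ compι h k P Q f s I' hI' J' hJ' :=
    fun s S hSs I' hI' J' hJ' hle => map_comp_compι_eq h k P Q f s _ _ _ _ _ _
  have hθ' : ∀ s I' (hI' : I' ∈ P.side s) J' (hJ' : J' ∈ Q.side (decide (k ∈ I'))),
      θ s (joinFace h k I' J') (joinFace_mem h k P Q s hI' hJ') =
        compι h k P Q f s I' hI' J' hJ' := fun s I' hI' J' hJ' => by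
    rw [hθ s _ _ I' hI' J' hJ' le_rfl]
    exact compι_naturality h k P Q f s le_rfl le_rfl hI' hI' hJ' hJ'
  -- it amounts to the same to be compatible with the coprojections of all faces or of all pairs
  have huniq : ∀ e : joinMap (P.comp h k Q) f ≅
        joinMap P (insertAt h k f (joinMap Q fun j => f (innerPos h k j))),
      (∀ s S hS, joinι (P.comp h k Q) f s S hS ≫ vertexMap e.hom s = θ s S hS) ↔
      ∀ (s : Bool) (I : Finset (Fin n)) (hI : I ∈ P.side s) (J : Finset (Fin m))
        (hJ : J ∈ Q.side (decide (k ∈ I))),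
        joinι (P.comp h k Q) f s (joinFace h k I J) (joinFace_mem h k P Q s hI hJ) ≫
            vertexMap e.hom s = compι h k P Q f s I hI J hJ := by
    refine fun e => ⟨fun he s I hI J hJ => by rw [he, hθ'], fun he s S hSs => ?_⟩
    obtain ⟨I', hI', J', hJ', rfl⟩ := exists_joinFace_eq h k P Q s hSs
    rw [he s I' hI' J' hJ', hθ']
  refine (existsUnique_congr fun e => (huniq e)).1
    (existsUnique_joinIso (P.comp h k Q) f _ θ ?_ ?_ ?_ ?_)
  · intro s S S' hSS' hSs hSs'
    rw [hθ s S hSs _ (hI s S' hSs') _ (hJ s S' hSs') (hSS'.trans (hS s S' hSs').ge),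
      ← Functor.map_comp_assoc]
    rfl
  · intro S hSs
    rw [hθ true S _ _ (P.side_mono (Bool.false_le true) (hI false S hSs)) _ (hJ false S hSs)
      (hS false S hSs).ge, Category.assoc, compι, Category.assoc, joinι_edge, compι]
  · intro s
    -- the inverse is assembled from the colimits over `J`, one for each `I`
    choose β hβ using fun I' (hI' : I' ∈ P.side s) => exists_compFaceMap_desc h k Q f I'
      (fun J' hJ' => joinι (P.comp h k Q) f s (joinFace h k I' J')
        (joinFace_mem h k P Q s hI' hJ')) fun J' J'' hJJ _ _ => joinι_naturality _ _ _ _ _ _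
    obtain ⟨u, hu⟩ := exists_joinι_desc P
      (insertAt h k f (joinMap Q fun j => f (innerPos h k j))) s β fun I' I'' hII hI' hI'' => by
        refine compFaceMap_hom_ext h k Q f I' fun J' hJ' => ?_
        have hJ'' : J' ∈ Q.side (decide (k ∈ I'')) := Q.side_mono (decide_mem_mono hII k) hJ'
        rw [hβ, ← Category.assoc, ← compFaceMap_naturality h k f _ hII le_rfl _
          (joinι Q (fun j => f (innerPos h k j)) (decide (k ∈ I'')) J' hJ''), Category.assoc,
          hβ, joinι_naturality]
        rw [joinι_edge, joinι_naturality]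
    refine ⟨u, fun S hSs => ?_⟩
    obtain ⟨I', hI', J', hJ', rfl⟩ := exists_joinFace_eq h k P Q s hSs
    rw [hθ' s I' hI' J' hJ', compι, Category.assoc, hu, hβ]
  · intro s u u' huu'
    refine joinι_hom_ext fun I' hI' => compFaceMap_hom_ext h k Q f I' fun J' hJ' => ?_
    have := huu' _ (joinFace_mem h k P Q s hI' hJ')
    simpa only [hθ' s I' hI' J' hJ', compι, Category.assoc] using this

end Composition

/-! ### The algebra of isomorphism classes of arrows -/

section Algebra

variable {C : Type u} [Category.{v} C] [MonoidalCategory C] [HasFiniteColimits C]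

/-- The structure map of `P` on isomorphism classes of arrows. -/
noncomputable def joinClass {n : ℕ} (P : RelComplex n)
    (x : Fin n → Quotient (isIsomorphicSetoid (Arrow C))) :
    Quotient (isIsomorphicSetoid (Arrow C)) :=
  Quotient.mk _ (joinMap P fun i => (x i).out)

/-- `joinClass` is computed by any representatives, not only the chosen ones. -/
theorem joinClass_mk {n : ℕ} (P : RelComplex n) (f : Fin n → Arrow C) :
    joinClass P (fun i => Quotient.mk (isIsomorphicSetoid (Arrow C)) (f i)) =
      Quotient.mk _ (joinMap P f) :=
  Quotient.sound (nonempty_joinMap_iso P fun i => Quotient.exact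
    (Quotient.out_eq (Quotient.mk (isIsomorphicSetoid (Arrow C)) (f i))))

theorem insertAt_comp {X Y : Type*} {n m p : ℕ} (h : p + 1 = n + m) (k : Fin n) (F : X → Y)
    (x : Fin p → X) (y : X) :
    insertAt h k (fun q => F (x q)) (F y) = fun i => F (insertAt h k x y i) := by
  funext i
  by_cases hi : i = k <;> simp [insertAt, hi]

/-- The algebra structure on the isomorphism classes of arrows. -/
noncomputable def joinAlgebra [SymmetricCategory C] [∀ X : C, PreservesFiniteColimits (tensorLeft X)]
    [∀ X : C, PreservesFiniteColimits (tensorRight X)] :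
    joinOperad.Algebra (Quotient (isIsomorphicSetoid (Arrow C))) where
  map {_} P x := joinClass P x
  map_one x := by
    choose f hf using fun i => Quotient.exists_rep (x i)
    obtain rfl : (fun i => Quotient.mk _ (f i)) = x := funext hf
    exact (joinClass_mk _ f).trans (Quotient.sound (existsUnique_unit_iso f).exists.nonempty)
  map_act P σ x := by
    choose f hf using fun i => Quotient.exists_rep (x i)
    obtain rfl : (fun i => Quotient.mk _ (f i)) = x := funext hf
    exact (joinClass_mk _ f).trans ((Quotient.sound
      (existsUnique_act_iso P σ f).exists.nonempty).trans (joinClass_mk P (f ∘ σ.symm)).symm)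
  map_comp h k P Q x := by
    choose f hf using fun i => Quotient.exists_rep (x i)
    obtain rfl : (fun i => Quotient.mk _ (f i)) = x := funext hf
    rw [joinClass_mk Q, insertAt_comp, joinClass_mk P]
    exact (joinClass_mk _ f).trans (Quotient.sound (existsUnique_comp_iso h k P Q f).exists.nonempty)

end Algebra

/-! ### The substitution and the composition operads -/

section SubstitutionAndComposition

variable {n m p : ℕ}

theorem RelComplex.ofSubst_act (K : SimplicialCpx n) (hK : (K : Set (Finset (Fin n))).Nonempty)
    (σ : Equiv.Perm (Fin n)) (hK' : (K.act σ : Set (Finset (Fin n))).Nonempty) :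
    (RelComplex.ofSubst K hK).act σ = RelComplex.ofSubst (K.act σ) hK' := by
  refine RelComplex.ext rfl ?_
  ext I
  simp [RelComplex.act, RelComplex.ofSubst]

theorem RelComplex.ofCompo_act (K : SimplicialCpx n) (hK : (K : Set (Finset (Fin n))).Nonempty)
    (σ : Equiv.Perm (Fin n)) (hK' : (K.act σ : Set (Finset (Fin n))).Nonempty) :
    (RelComplex.ofCompo K hK).act σ = RelComplex.ofCompo (K.act σ) hK' := by
  refine RelComplex.ext ?_ rfl
  ext I
  simp [RelComplex.act, RelComplex.ofCompo]

theorem coe_joinAction_trivial (h : p + 1 = n + m) (k : Fin n) (K : SimplicialCpx n)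
    (M : SimplicialCpx m) :
    (SimplicialCpx.joinAction h k K M (SimplicialCpx.trivial m) : Set (Finset (Fin p))) =
      SimplicialCpx.subst h k K M := by
  ext S
  have hk : k ∉ SimplicialCpx.outerPart h k S := by simp
  rw [SetLike.mem_coe, SimplicialCpx.mem_joinAction, SimplicialCpx.mem_trivial]
  constructor
  · rintro (⟨h1, h2⟩ | ⟨h1, h2⟩)
    · exact ⟨_, h1, (Finset.erase_insert hk).symm, Or.inl ⟨Finset.mem_insert_self _ _, h2⟩⟩
    · exact ⟨_, h1, (Finset.erase_eq_of_notMem hk).symm, Or.inr ⟨hk, h2⟩⟩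
  · rintro ⟨I, hI, h1, ⟨h2, h3⟩ | ⟨h2, h3⟩⟩
    · rw [h1, Finset.insert_erase h2]
      exact Or.inl ⟨hI, h3⟩
    · rw [h1, Finset.erase_eq_of_notMem h2]
      exact Or.inr ⟨hI, h3⟩

theorem coe_joinAction_simplex (h : p + 1 = n + m) (k : Fin n) (K : SimplicialCpx n)
    (M : SimplicialCpx m) :
    (SimplicialCpx.joinAction h k K (SimplicialCpx.simplex m) M : Set (Finset (Fin p))) =
      SimplicialCpx.compo h k K M := by
  ext S
  have hk : k ∉ SimplicialCpx.outerPart h k S := by simp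
  rw [SetLike.mem_coe, SimplicialCpx.mem_joinAction]
  constructor
  · rintro (⟨h1, -⟩ | ⟨h1, h2⟩)
    · exact ⟨_, h1, (Finset.erase_insert hk).symm, Or.inl (Finset.mem_insert_self _ _)⟩
    · exact ⟨_, h1, (Finset.erase_eq_of_notMem hk).symm, Or.inr ⟨hk, h2⟩⟩
  · rintro ⟨I, hI, h1, h2 | ⟨h2, h3⟩⟩
    · rw [h1, Finset.insert_erase h2]
      exact Or.inl ⟨hI, SimplicialCpx.mem_simplex _⟩
    · rw [h1, Finset.erase_eq_of_notMem h2]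
      exact Or.inr ⟨hI, h3⟩

theorem trivial_joinAction_trivial (h : p + 1 = n + m) (k : Fin n) (M : SimplicialCpx m) :
    SimplicialCpx.joinAction h k (SimplicialCpx.trivial n) M (SimplicialCpx.trivial m) =
      SimplicialCpx.trivial p := by
  ext S
  simp only [SetLike.mem_coe, SimplicialCpx.mem_joinAction, SimplicialCpx.mem_trivial,
    Finset.insert_ne_empty, false_and, false_or]
  rw [← Finset.subset_empty, ← Finset.subset_empty, ← subset_joinFace_iff]
  have : joinFace h k ∅ ∅ = ∅ := by simp [joinFace]
  rw [this, Finset.subset_empty]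

theorem simplex_joinAction_simplex (h : p + 1 = n + m) (k : Fin n) (M : SimplicialCpx m) :
    SimplicialCpx.joinAction h k (SimplicialCpx.simplex n) (SimplicialCpx.simplex m) M =
      SimplicialCpx.simplex p := by
  ext S
  simp [SimplicialCpx.mem_joinAction]

variable {C : Type u} [Category.{v} C] [MonoidalCategory C] [HasFiniteColimits C]

/-- When the complex is a full simplex on a face `I`, the colimit is the value at `I`. -/
theorem isIso_polyhedralι (K : SimplicialCpx n) (f : Fin n → Arrow C) {I : Finset (Fin n)}
    (hI : I ∈ K) (htop : ∀ J ∈ K, J ≤ I) : IsIso (polyhedralι K f I hI) :=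
  isIso_ι_of_isTerminal (IsTerminal.ofUniqueHom (Y := (⟨I, hI⟩ : FaceCat K))
    (fun J => homOfLE (htop J.1 J.2)) fun _ _ => Subsingleton.elim _ _) (diagram K f)

theorem polyhedralι_polyhedralMap {L K : SimplicialCpx n} (h : L ≤ K) (f : Fin n → Arrow C)
    {I : Finset (Fin n)} (hI : I ∈ L) :
    polyhedralι L f I hI ≫ polyhedralMap h f = polyhedralι K f I (h hI) :=
  colimit.ι_pre (diagram K f) (faceCatIncl h) (⟨I, hI⟩ : FaceCat L)

theorem existsUnique_ofSubst_iso (K : SimplicialCpx n) (hK : (K : Set (Finset (Fin n))).Nonempty)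
    (f : Fin n → Arrow C) :
    ∃! e : joinMap (RelComplex.ofSubst K hK) f ≅ substMap K hK f,
      polyhedralι (SimplicialCpx.trivial n) f ∅ ((SimplicialCpx.mem_trivial ∅).2 rfl) ≫ e.hom.left =
          𝟙 ((cubical f).obj ∅) ∧
        e.hom.right = 𝟙 (polyhedral K f) := by
  have hiso := isIso_polyhedralι (SimplicialCpx.trivial n) f ((SimplicialCpx.mem_trivial ∅).2 rfl)
    fun J hJ => ((SimplicialCpx.mem_trivial J).1 hJ).le
  refine ⟨Arrow.isoMk (asIso (polyhedralι (SimplicialCpx.trivial n) f ∅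
    ((SimplicialCpx.mem_trivial ∅).2 rfl))).symm (Iso.refl (polyhedral K f)) ?_, ⟨?_, rfl⟩, ?_⟩
  · have h : polyhedralι (SimplicialCpx.trivial n) f ∅ ((SimplicialCpx.mem_trivial ∅).2 rfl) ≫
        polyhedralMap (RelComplex.ofSubst K hK).le f =
          polyhedralι K f ∅ (SimplicialCpx.empty_mem hK) := polyhedralι_polyhedralMap _ _ _
    exact ((IsIso.inv_comp_eq _).2 h.symm).trans (Category.comp_id _).symm
  · exact IsIso.hom_inv_id _
  · rintro e ⟨h1, h2⟩
    ext1
    refine Arrow.hom_ext _ _ ?_ h2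
    exact (cancel_epi (polyhedralι (SimplicialCpx.trivial n) f ∅ _)).1
      (h1.trans (IsIso.hom_inv_id _).symm)

theorem existsUnique_ofCompo_iso (K : SimplicialCpx n) (hK : (K : Set (Finset (Fin n))).Nonempty)
    (f : Fin n → Arrow C) :
    ∃! e : joinMap (RelComplex.ofCompo K hK) f ≅ compoMap K f,
      e.hom.left = 𝟙 (polyhedral K f) ∧
        polyhedralι (SimplicialCpx.simplex n) f Finset.univ (SimplicialCpx.mem_simplex _) ≫
            e.hom.right = 𝟙 ((cubical f).obj Finset.univ) := by
  have hiso := isIso_polyhedralι (SimplicialCpx.simplex n) f (SimplicialCpx.mem_simplex Finset.univ)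
    fun J _ => Finset.subset_univ J
  refine ⟨Arrow.isoMk (Iso.refl (polyhedral K f)) (asIso (polyhedralι (SimplicialCpx.simplex n) f
    Finset.univ (SimplicialCpx.mem_simplex _))).symm ?_, ⟨rfl, ?_⟩, ?_⟩
  · have h : (compoMap K f).hom ≫ polyhedralι (SimplicialCpx.simplex n) f Finset.univ
        (SimplicialCpx.mem_simplex _) = polyhedralMap (RelComplex.ofCompo K hK).le f := by
      refine colimit.hom_ext fun I => ?_
      refine (colimit.ι_desc_assoc _ _ _).trans
        (Eq.trans ?_ (polyhedralι_polyhedralMap (RelComplex.ofCompo K hK).le f I.2).symm)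
      exact joinι_naturality (RelComplex.ofCompo K hK) f true (Finset.subset_univ I.1)
        (SimplicialCpx.mem_simplex _) (SimplicialCpx.mem_simplex _)
    have h' := (IsIso.eq_comp_inv (polyhedralι (SimplicialCpx.simplex n) f Finset.univ
      (SimplicialCpx.mem_simplex _))).2 h
    exact (Category.id_comp _).trans h'
  · exact IsIso.hom_inv_id _
  · rintro e ⟨h1, h2⟩
    ext1
    refine Arrow.hom_ext _ _ h1 ?_
    exact (cancel_epi (polyhedralι (SimplicialCpx.simplex n) f Finset.univ _)).1
      (h2.trans (IsIso.hom_inv_id _).symm)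

end SubstitutionAndComposition

end JoinOperad

theorem theorem4p13 {C : Type u} [Category.{v} C] [MonoidalCategory C] [SymmetricCategory C]
    [HasFiniteColimits C] [∀ X : C, PreservesFiniteColimits (tensorLeft X)]
    [∀ X : C, PreservesFiniteColimits (tensorRight X)] :
    -- the structure maps make the arrows, up to isomorphism, an algebra over the operad
    (∃ A : joinOperad.Algebra (Quotient (isIsomorphicSetoid (Arrow C))),
      ∀ (n : ℕ) (P : RelComplex n) (f : Fin n → Arrow C),
        A.map (n := n) P (fun i => Quotient.mk _ (f i)) = Quotient.mk _ (joinMap P f)) ∧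
    -- canonical isomorphism for the unit
    (∀ f : Fin 1 → Arrow C, ∃! e : joinMap RelComplex.unit f ≅ f 0,
      ∀ (s : Bool) (I : Finset (Fin 1)) (hI : I ∈ RelComplex.unit.side s),
        joinι RelComplex.unit f s I hI ≫ vertexMap e.hom s = unitFaceMap f s I hI) ∧
    -- canonical isomorphisms for the symmetric group actions
    (∀ (n : ℕ) (P : RelComplex n) (σ : Equiv.Perm (Fin n)) (f : Fin n → Arrow C),
      ∃! e : joinMap (P.act σ) f ≅ joinMap P (f ∘ σ.symm),
        ∀ (s : Bool) (I : Finset (Fin n)) (hI : I ∈ (P.act σ).side s),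
          joinι (P.act σ) f s I hI ≫ vertexMap e.hom s =
            permFaceMap σ f I ≫ joinι P (f ∘ σ.symm) s (I.map σ.toEmbedding)
              (P.mem_side_act σ s hI)) ∧
    -- canonical isomorphisms for the partial compositions
    (∀ (n m p : ℕ) (h : p + 1 = n + m) (k : Fin n) (P : RelComplex n) (Q : RelComplex m)
        (f : Fin p → Arrow C),
      ∃! e : joinMap (P.comp h k Q) f ≅
          joinMap P (insertAt h k f (joinMap Q fun j => f (innerPos h k j))),
        ∀ (s : Bool) (I : Finset (Fin n)) (hI : I ∈ P.side s) (J : Finset (Fin m))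
          (hJ : J ∈ Q.side (decide (k ∈ I))),
          joinι (P.comp h k Q) f s (joinFace h k I J) (joinFace_mem h k P Q s hI hJ) ≫
              vertexMap e.hom s =
            compFaceMap h k f (joinMap Q fun j => f (innerPos h k j)) I J
                (joinι Q (fun j => f (innerPos h k j)) (decide (k ∈ I)) J hJ) ≫
              joinι P (insertAt h k f (joinMap Q fun j => f (innerPos h k j))) s I hI) ∧
    -- restriction to the pairs `(K, {∅})`: the substitution operad and its algebra
    (RelComplex.unit.K = SimplicialCpx.simplex 1 ∧ RelComplex.unit.L = SimplicialCpx.trivial 1 ∧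
      (∀ (n : ℕ) (K : SimplicialCpx n) (hK : (K : Set (Finset (Fin n))).Nonempty)
        (σ : Equiv.Perm (Fin n)), ∃ hK' : (K.act σ : Set (Finset (Fin n))).Nonempty,
          (RelComplex.ofSubst K hK).act σ = RelComplex.ofSubst (K.act σ) hK' ∧
          (RelComplex.ofCompo K hK).act σ = RelComplex.ofCompo (K.act σ) hK') ∧
      (∀ (n m p : ℕ) (h : p + 1 = n + m) (k : Fin n) (K : SimplicialCpx n) (M : SimplicialCpx m)
        (hK : (K : Set (Finset (Fin n))).Nonempty) (hM : (M : Set (Finset (Fin m))).Nonempty),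
        (((RelComplex.ofSubst K hK).comp h k (RelComplex.ofSubst M hM)).K : Set (Finset (Fin p))) =
            SimplicialCpx.subst h k K M ∧
          ((RelComplex.ofSubst K hK).comp h k (RelComplex.ofSubst M hM)).L = SimplicialCpx.trivial p) ∧
      (∀ (n : ℕ) (K : SimplicialCpx n) (hK : (K : Set (Finset (Fin n))).Nonempty) (f : Fin n → Arrow C),
        ∃! e : joinMap (RelComplex.ofSubst K hK) f ≅ substMap K hK f,
          polyhedralι (SimplicialCpx.trivial n) f ∅ ((SimplicialCpx.mem_trivial ∅).2 rfl) ≫ e.hom.left =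
              𝟙 ((cubical f).obj ∅) ∧
            e.hom.right = 𝟙 (polyhedral K f))) ∧
    -- restriction to the pairs `(Δ, K)`: the composition operad and its algebra
    ((∀ (n m p : ℕ) (h : p + 1 = n + m) (k : Fin n) (K : SimplicialCpx n) (M : SimplicialCpx m)
        (hK : (K : Set (Finset (Fin n))).Nonempty) (hM : (M : Set (Finset (Fin m))).Nonempty),
        ((RelComplex.ofCompo K hK).comp h k (RelComplex.ofCompo M hM)).K = SimplicialCpx.simplex p ∧
          (((RelComplex.ofCompo K hK).comp h k (RelComplex.ofCompo M hM)).L :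
            Set (Finset (Fin p))) = SimplicialCpx.compo h k K M) ∧
      (∀ (n : ℕ) (K : SimplicialCpx n) (hK : (K : Set (Finset (Fin n))).Nonempty) (f : Fin n → Arrow C),
        ∃! e : joinMap (RelComplex.ofCompo K hK) f ≅ compoMap K f,
          e.hom.left = 𝟙 (polyhedral K f) ∧
            polyhedralι (SimplicialCpx.simplex n) f Finset.univ (SimplicialCpx.mem_simplex _) ≫ e.hom.right =
              𝟙 ((cubical f).obj Finset.univ))) := by
  refine ⟨⟨joinAlgebra, fun n P f => joinClass_mk P f⟩, existsUnique_unit_iso,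
    fun n P σ f => existsUnique_act_iso P σ f, fun n m p h k P Q f => ?_,
    ⟨rfl, rfl, fun n K hK σ => ?_, fun n m p h k K M hK hM => ⟨?_, ?_⟩,
      fun n K hK f => existsUnique_ofSubst_iso K hK f⟩,
    fun n m p h k K M hK hM => ⟨?_, ?_⟩, fun n K hK f => existsUnique_ofCompo_iso K hK f⟩
  · exact existsUnique_comp_iso h k P Q f
  · have hK' : (K.act σ : Set (Finset (Fin n))).Nonempty :=
      ⟨∅, by simpa using SimplicialCpx.empty_mem hK⟩
    exact ⟨hK', RelComplex.ofSubst_act K hK σ hK', RelComplex.ofCompo_act K hK σ hK'⟩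
  · exact coe_joinAction_trivial h k K M
  · exact trivial_joinAction_trivial h k M
  · exact simplex_joinAction_simplex h k M
  · exact coe_joinAction_simplex h k K M
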